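/- **Spooky pebbling.** Let $G=(V,E)$ be a finite directed acyclic graph (DAG). A *root* (output) is a vertex of out-degree $0$; let $R$ be the set of roots. A *spooky pebbling strategy* is a sequence $(P_0,S_0),\dots,(P_T,S_T)$ of pairs of subsets of $V$ (pebbles and ghosts) with $P_0=S_0=\emptyset$, $P_T=R$, $S_T=\emptyset$, such that for each $t\in\{1,\dots,T\}$ there is $v\in V$ with one of - *pebble:* $P_t=P_{t-1}\cup\{v\}$, $S_t=S_{t-1}$, and all direct predecessors of $v$ are in $P_{t-1}$; - *unpebble:* $P_t=P_{t-1}\setminus\{v\}$, $S_t=S_{t-1}$, and all direct predecessors of $v$ are in $P_{t-1}$; - *ghost:* $P_t=P_{t-1}\setminus\{v\}$, $S_t=S_{t-1}\cup\{v\}$; - *unghost:* $P_t=P_{t-1}\cup\{v\}$, $S_t=S_{t-1}\setminus\{v\}$, and all direct predecessors of $v$ are in $P_{t-1}$. $G$ *can be spooky pebbled with $P$ pebbles* if there is such a strategy with $|P_t|\le P$ for all $t$. **The graph of a formula.** Let $\Phi=Q_1x_1\cdots Q_nx_n\,(C_1\wedge\dots\wedge C_m)$ with $Q_i\in\{\forall,\exists\}$,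 each $C_j$ a disjunction of at most three different literals. A *$k$-pyramid* has vertices $(a,b)$, $a,b\ge 0$, $a+b<k$, edges $(a+1,b)\to(a,b)$ and $(a,b+1)\to(a,b)$, and apex $(0,0)$. Put $s_i=3(n-i+1)+3$. The Gilbert–Lengauer–Tarjan type graph $G(\Phi)$ has the following vertices. - Clauses: $p_0$ is a source; $p_j$ has as predecessors $p_{j-1}$, the literal vertices of the literals in $C_j$, and $3-|C_j|$ private sources ($1\le j\le m$). Put $q_{n+1}=p_m$. - For each $i$, three disjoint pyramids of sizes $s_i,s_i-1,s_i-2$ with apexes $a_i,d_i,c_i$, the literal vertices $x_i,\bar x_i$, and vertices $g_i,q_i$. - If $Q_i=\exists$, there is one more vertex $\bar x_i'$, and the predecessor sets are: $\bar x_i'\colon\{a_i,c_i\}$; $x_i\colon\{a_i\}$; $\bar x_i\colon\{\bar x_i'\}$; $g_i\colon\{q_{i+1},d_i,x_i,\bar x_i\}$; $q_i\colon\{g_i,\bar x_i'\}$. - If $Q_i=\forall$, the predecessor sets are: $x_i\colon\{c_i\}$; $\bar x_i\colon\{a_i\}$; $g_i\colon\{q_{i+1},d_i,a_i,x_i\}$;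 $q_i\colon\{q_{i+1},g_i,c_i,\bar x_i\}$. Its output is $q_1$. For $k\ge1$ the *diamond* $G^\diamond_k$ has vertices $\{1,\dots,k\}^2$ and edges $(a,b)\to(a+1,b)$, $(a,b)\to(a,b+1)$. Let $G'(\Phi)$ be the graph obtained from $G(\Phi)$ and $G^\diamond_{3n+4}$ by identifying $q_1$ with the input $(1,1)$ of the diamond. For a quantified Boolean formula $F=Q_1x_1\cdots Q_nx_n\,\varphi$ with an arbitrary Boolean formula $\varphi$ (built from constants, variables, $\neg,\wedge,\vee$), let $\Phi_F$ be its Tseitin form: each occurrence of a constant, conjunction or disjunction in $\varphi$ gets a new variable, existentially quantified innermost, with clauses of at most three literals saying that it is equivalent to that subformula, and one more clause asserts $\varphi$. **Theorem.** There is a constant $C$ such that: 1. For every $\Phi$ as above, with $n$ variables and $m$ clauses, $G'(\Phi)$ is a finite DAG with exactly one output and at most $C(n+m+1)^3$ vertices, and $\Phi$ is true if and only if $G'(\Phi)$ can be spooky pebbled with $P=3n+5$ pebbles. 2. For every quantified Boolean formula $F$, $G'(\Phi_F)$ is a finite DAG with exactly one output and at most $C|F|^3$ vertices, where $|F|$ is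 the number of quantifiers of $F$ plus the number of nodes of the syntax tree of its matrix, and $F$ is true if and only if $G'(\Phi_F)$ can be spooky pebbled with $P=3N+5$ pebbles, where $N$ is the number of variables of $\Phi_F$. In particular, for every quantified Boolean formula $F$ there are a DAG $G'$ with one output and a number $P$, given by an explicit construction of polynomial size, such that $F$ is true if and only if $G'$ can be spooky pebbled with $P$ pebbles. -/

import Mathlib

/-! ### The spooky pebble game -/

section Pebbling

variable {V : Type*}

/-- Edges are directed from a vertex to the vertices that depend on it. -/
def Digraph.IsAcyclic (G : Digraph V) : Prop :=
  ∀ v, ¬ Relation.TransGen G.Adj v v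

/-- A root (output) is a vertex of out-degree zero. -/
def Digraph.IsRoot (G : Digraph V) (v : V) : Prop :=
  ∀ w, ¬ G.Adj v w

variable [DecidableEq V]

/-- One move of the spooky pebble game, from pebbles `P` and ghosts `S` to pebbles `P'` and
ghosts `S'`: pebble, unpebble, ghost or unghost a vertex `v`. -/
def SpookyMove (G : Digraph V) (P S P' S' : Finset V) : Prop :=
  ∃ v : V,
    (P' = P ∪ {v} ∧ S' = S ∧ ∀ u, G.Adj u v → u ∈ P) ∨
    (P' = P \ {v} ∧ S' = S ∧ ∀ u, G.Adj u v → u ∈ P) ∨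
    (P' = P \ {v} ∧ S' = S ∪ {v}) ∨
    (P' = P ∪ {v} ∧ S' = S \ {v} ∧ ∀ u, G.Adj u v → u ∈ P)

/-- `(P 0, S 0), …, (P T, S T)` is a spooky pebbling strategy on `G`. -/
structure IsSpookyStrategy (G : Digraph V) (T : ℕ) (P S : ℕ → Finset V) : Prop where
  pebbles_zero : P 0 = ∅
  ghosts_zero : S 0 = ∅
  pebbles_end : ∀ v, v ∈ P T ↔ G.IsRoot v
  ghosts_end : S T = ∅
  move : ∀ t < T, SpookyMove G (P t) (S t) (P (t + 1)) (S (t + 1))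

/-- `G` can be spooky pebbled with `k` pebbles: there is a spooky pebbling strategy of pebbling
cost at most `k` (the number of ghosts is not restricted). -/
def SpookyPebblable (G : Digraph V) (k : ℕ) : Prop :=
  ∃ (T : ℕ) (P S : ℕ → Finset V), IsSpookyStrategy G T P S ∧ ∀ t ≤ T, (P t).card ≤ k

end Pebbling

/-! ### Quantified Boolean formulas -/

inductive Quantifier
  | all
  | ex
  deriving DecidableEq

/-- Truth of `Q₀ x₀ Q₁ x₁ … Qₙ₋₁ xₙ₋₁ F` (`x₀` is quantified outermost). -/
def QuantTrue : (n : ℕ) → (Fin n → Quantifier) → ((Fin n → Bool) → Prop) → Prop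
  | 0, _, F => F Fin.elim0
  | n + 1, Q, F =>
    match Q 0 with
    | .all => ∀ b : Bool, QuantTrue n (fun i => Q i.succ) (fun σ => F (Fin.cons b σ))
    | .ex => ∃ b : Bool, QuantTrue n (fun i => Q i.succ) (fun σ => F (Fin.cons b σ))

/-- Boolean formulas in the variables `x₀, …, xₙ₋₁`. -/
inductive BoolFormula (n : ℕ)
  | const (b : Bool)
  | var (i : Fin n)
  | neg (φ : BoolFormula n)
  | and (φ ψ : BoolFormula n)
  | or (φ ψ : BoolFormula n)

namespace BoolFormula

def eval {n : ℕ} (σ : Fin n → Bool) : BoolFormula n → Bool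
  | const b => b
  | var i => σ i
  | neg φ => !(φ.eval σ)
  | and φ ψ => φ.eval σ && ψ.eval σ
  | or φ ψ => φ.eval σ || ψ.eval σ

def size {n : ℕ} : BoolFormula n → ℕ
  | const _ => 1
  | var _ => 1
  | neg φ => φ.size + 1
  | and φ ψ => φ.size + ψ.size + 1
  | or φ ψ => φ.size + ψ.size + 1

end BoolFormula

/-- A quantified Boolean formula `Q₀ x₀ … Qₙ₋₁ xₙ₋₁ F` with an arbitrary matrix `F`. -/
structure QBF where
  numVars : ℕ
  quant : Fin numVars → Quantifier
  matrix : BoolFormula numVars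

namespace QBF

def IsTrue (F : QBF) : Prop :=
  QuantTrue F.numVars F.quant (fun σ => F.matrix.eval σ = true)

def size (F : QBF) : ℕ := F.numVars + F.matrix.size

end QBF

/-- The literal `(i, true)` is `xᵢ`, the literal `(i, false)` is its negation. -/
abbrev Literal (n : ℕ) := Fin n × Bool

/-- The negation of a literal. -/
def Literal.not {n : ℕ} (l : Literal n) : Literal n := (l.1, !l.2)

/-- A clause: a disjunction of at most three different literals. -/
abbrev Clause (n : ℕ) := {c : Finset (Literal n) // c.card ≤ 3}

/-- The clause `a ∨ b ∨ c` (shorter if literals coincide). -/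
def Clause.of {n : ℕ} (a b c : Literal n) : Clause n := ⟨{a, b, c}, Finset.card_le_three⟩

/-- A quantified Boolean formula whose matrix is a conjunction of clauses of at most three
literals. -/
structure QCNF where
  numVars : ℕ
  quant : Fin numVars → Quantifier
  clauses : List (Clause numVars)

namespace QCNF

def IsTrue (Φ : QCNF) : Prop :=
  QuantTrue Φ.numVars Φ.quant (fun σ => ∀ c ∈ Φ.clauses, ∃ l ∈ c.1, σ l.1 = l.2)

def numClauses (Φ : QCNF) : ℕ := Φ.clauses.length

def size (Φ : QCNF) : ℕ := Φ.numVars + Φ.numClauses + 1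

end QCNF

/-! ### Bringing the matrix into clausal form (Tseitin's transformation)

Every constant, conjunction and disjunction in the matrix gets a new variable, existentially
quantified innermost, with clauses saying that it is equivalent to the subformula. -/

namespace BoolFormula

/-- The number of new variables. -/
def auxCount {n : ℕ} : BoolFormula n → ℕ
  | const _ => 1
  | var _ => 0
  | neg φ => φ.auxCount
  | and φ ψ => φ.auxCount + ψ.auxCount + 1
  | or φ ψ => φ.auxCount + ψ.auxCount + 1

/-- A literal that stands for the formula, and the clauses that define the new variables. The map
`x` names the variables of the formula, the map `y` names the new variables. -/
def tseitin {n N : ℕ} (x : Fin n → Fin N) :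
    (φ : BoolFormula n) → (Fin φ.auxCount → Fin N) → Literal N × List (Clause N)
  | const b, y =>
    let z := y (Fin.last 0)
    ((z, true), [Clause.of (z, b) (z, b) (z, b)])
  | var i, _ => ((x i, true), [])
  | neg φ, y =>
    let A := φ.tseitin x y
    (A.1.not, A.2)
  | and φ ψ, y =>
    let A := φ.tseitin x (fun i => y (i.castAdd ψ.auxCount).castSucc)
    let B := ψ.tseitin x (fun i => y (i.natAdd φ.auxCount).castSucc)
    let z : Literal N := (y (Fin.last _), true)
    (z, Clause.of z.not A.1 A.1 :: Clause.of z.not B.1 B.1 :: Clause.of z A.1.not B.1.not ::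
      (A.2 ++ B.2))
  | or φ ψ, y =>
    let A := φ.tseitin x (fun i => y (i.castAdd ψ.auxCount).castSucc)
    let B := ψ.tseitin x (fun i => y (i.natAdd φ.auxCount).castSucc)
    let z : Literal N := (y (Fin.last _), true)
    (z, Clause.of z A.1.not A.1.not :: Clause.of z B.1.not B.1.not :: Clause.of z.not A.1 B.1 ::
      (A.2 ++ B.2))

end BoolFormula

/-- The clausal form of a quantified Boolean formula. -/
def QBF.toQCNF (F : QBF) : QCNF where
  numVars := F.numVars + F.matrix.auxCount
  quant := Fin.append F.quant (fun _ => Quantifier.ex)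
  clauses :=
    let A := F.matrix.tseitin (Fin.castAdd F.matrix.auxCount) (Fin.natAdd F.numVars)
    Clause.of A.1 A.1 A.1 :: A.2

/-! ### The graph of Gilbert, Lengauer and Tarjan -/

/-- The vertices of the pyramid of size `k`: row `0` is the apex, and row `r` consists of the
`r + 1` positions `(a, b)` with `a + b = r`; the last row has `k` vertices, the sources. -/
abbrev PyramidVertex (k : ℕ) := {v : Fin k × Fin k // v.1.val + v.2.val < k}

/-- The edges of the pyramid: `(a + 1, b) → (a, b)` and `(a, b + 1) → (a, b)`. -/
def PyramidVertex.Adj {k : ℕ} (u v : PyramidVertex k) : Prop :=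
  (u.1.1.val = v.1.1.val + 1 ∧ u.1.2 = v.1.2) ∨ (u.1.1 = v.1.1 ∧ u.1.2.val = v.1.2.val + 1)

namespace QCNF

/-- The sizes `sᵢ`, `sᵢ - 1`, `sᵢ - 2` of the three pyramids of the block of `xᵢ`, where
`sᵢ = 3 (n - i) + 3` and `x₀` is the outermost variable. -/
def pyramidSize (Φ : QCNF) (i : Fin Φ.numVars) (r : Fin 3) : ℕ :=
  3 * (Φ.numVars - i.val) + 3 - r.val

theorem pyramidSize_pos (Φ : QCNF) (i : Fin Φ.numVars) (r : Fin 3) : 0 < Φ.pyramidSize i r := by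
  unfold pyramidSize
  omega

/-- The vertices of the graph.
* `pyr i r v`: the three pyramids (`r = 0, 1, 2`) of the block of `xᵢ`;
* `lit i b`: the vertex of the literal `xᵢ` (`b = true`) or of its negation (`b = false`);
* `bar i h`: only for existential `xᵢ`, the vertex below the negative literal;
* `wit i`: passed when the rest of the graph has been pebbled (for the first time) under `xᵢ`;
* `out i`: the output of the block of `xᵢ`;
* `chk j`: the first `j` clauses have been checked;
* `pad j k`: sources that fill up the `j`-th clause to three inputs. -/
inductive Vertex (Φ : QCNF)
  | pyr (i : Fin Φ.numVars) (r : Fin 3) (v : PyramidVertex (Φ.pyramidSize i r))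
  | lit (i : Fin Φ.numVars) (b : Bool)
  | bar (i : Fin Φ.numVars) (h : Φ.quant i = Quantifier.ex)
  | wit (i : Fin Φ.numVars)
  | out (i : Fin Φ.numVars)
  | chk (j : Fin (Φ.numClauses + 1))
  | pad (j : Fin Φ.numClauses) (k : Fin (3 - (Φ.clauses.get j).1.card))
  deriving DecidableEq

variable (Φ : QCNF)

/-- The apex of the `r`-th pyramid of the block of `xᵢ`. -/
def apex (i : Fin Φ.numVars) (r : Fin 3) : Φ.Vertex :=
  .pyr i r ⟨(⟨0, Φ.pyramidSize_pos i r⟩, ⟨0, Φ.pyramidSize_pos i r⟩), Φ.pyramidSize_pos i r⟩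

/-- The output of the part of the graph that belongs to `xᵢ, …, xₙ₋₁` and the clauses. -/
def outFrom (i : ℕ) : Φ.Vertex :=
  if h : i < Φ.numVars then .out ⟨i, h⟩ else .chk (Fin.last _)

/-- The vertex below the literal `xᵢ` (`b = true`) or its negation (`b = false`). It is the apex of
a pyramid, except below the negative literal of an existential variable. -/
def belowLit (i : Fin Φ.numVars) (b : Bool) : Φ.Vertex :=
  if h : Φ.quant i = Quantifier.ex then
    (if b then Φ.apex i 0 else .bar i h)
  else
    (if b then Φ.apex i 2 else Φ.apex i 0)

/-- The direct predecessors of a vertex. -/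
def preds : Φ.Vertex → Set Φ.Vertex
  | .pyr i r v => {u | ∃ w, w.Adj v ∧ u = .pyr i r w}
  | .lit i b => {Φ.belowLit i b}
  | .bar i _ => {Φ.apex i 0, Φ.apex i 2}
  | .wit i =>
    match Φ.quant i with
    | .ex => {Φ.outFrom (i.val + 1), Φ.apex i 1, .lit i true, .lit i false}
    | .all => {Φ.outFrom (i.val + 1), Φ.apex i 1, .lit i true, Φ.belowLit i false}
  | .out i =>
    match Φ.quant i with
    | .ex => {.wit i, Φ.belowLit i false}
    | .all => {Φ.outFrom (i.val + 1), .wit i, Φ.belowLit i true, .lit i false}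
  | .chk j => {u | ∃ c : Fin Φ.numClauses, j = c.succ ∧
      (u = .chk c.castSucc ∨ (∃ l ∈ (Φ.clauses.get c).1, u = .lit l.1 l.2) ∨ ∃ k, u = .pad c k)}
  | .pad _ _ => ∅

/-- The graph of Gilbert, Lengauer and Tarjan; its output is `Φ.outFrom 0`. -/
def gltGraph : Digraph Φ.Vertex where
  Adj u v := u ∈ Φ.preds v

end QCNF

/-! ### The diamond and the graph for the spooky pebble game -/

/-- The `k × k` diamond, with input `(0, 0)` and output `(k - 1, k - 1)`: each vertex has an edge to
the next vertex in either coordinate. -/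
def diamond (k : ℕ) : Digraph (Fin k × Fin k) where
  Adj u v := (u.1.val + 1 = v.1.val ∧ u.2 = v.2) ∨ (u.1 = v.1 ∧ u.2.val + 1 = v.2.val)

/-- The vertices of the diamond other than its input. -/
abbrev DiamondInner (k : ℕ) := {v : Fin k × Fin k // ¬ (v.1.val = 0 ∧ v.2.val = 0)}

/-- The graph obtained from `G` and the `k × k` diamond by identifying the vertex `q` of `G` with
the input of the diamond. -/
def attachDiamond {V : Type*} (G : Digraph V) (q : V) (k : ℕ) : Digraph (V ⊕ DiamondInner k) where
  Adj
    | .inl u, .inl v => G.Adj u v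
    | .inl u, .inr v => u = q ∧ ∃ o : Fin k × Fin k,
        o.1.val = 0 ∧ o.2.val = 0 ∧ (diamond k).Adj o v.1
    | .inr u, .inr v => (diamond k).Adj u.1 v.1
    | .inr _, .inl _ => False

namespace QCNF

abbrev SpookyVertex (Φ : QCNF) := Φ.Vertex ⊕ DiamondInner (3 * Φ.numVars + 4)

/-- The diamond of size `3 n + 4` on top of the output of the graph of Gilbert, Lengauer and
Tarjan. -/
def spookyGraph (Φ : QCNF) : Digraph Φ.SpookyVertex :=
  attachDiamond Φ.gltGraph (Φ.outFrom 0) (3 * Φ.numVars + 4)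

end QCNF

/-! The link is the black pebble game, which has no ghosts and allows free removal. With `k = 3n +
4`, the formula is true iff the output of the graph below the diamond can be black pebbled with `k`
pebbles, iff the graph with the `k × k` diamond can be spooky pebbled with `k + 1` pebbles.

All lower bounds rest on one count: the last free path through a triangular grid with `r` sources
can only be blocked by placing a source, and then the grid carries at least `r` pebbles
(`IsGrid.card_of_block`). It is applied at the last time a grid is open before a vertex above it is
needed.

Black pebbling implies truth. If every earlier block keeps three pebbles, the block of `xᵢ` and
everything after it share `3(n - i) + 4` pebbles. The pyramid sizes drop by one because filling a
pyramid, while one pebble is kept for each pyramid filled before, uses exactly this budget. So when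
the third pyramid is filled, the later blocks are empty and must be pebbled from scratch; meanwhile
the block keeps three pebbles, and a fourth whenever the false literal is pebbled. An existential
block yields this for some value of `xᵢ`, a universal block for both (`hasPhase_ex`,
`hasPhase_all`). Under the resulting assignment, checking a false clause would take `3n + 5` pebbles
(`matrix_of_pebbled`). Conversely, a true formula is pebbled block by block with three pebbles kept
per block (`reach_of_trueFrom`).

Black to spooky. Every vertex but the output of the diamond can be pebbled with `k` pebbles, the
output with `k + 1`. Removed pebbles become ghosts; with one pebble kept on the output, the ghosts
are cleared from the top down by replaying black strategies (`exists_clear`).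

Spooky to black. When the upper half of the diamond is blocked for the last time, the pebble count
forces the placed source to be a corner of the diamond and all `k + 1` pebbles to lie on the
diamond. A side of the diamond must later be cleared down to its input, which is thus pebbled from
an empty graph, while one pebble is stuck in the upper half (`SpookyPebblable.exists_black`). -/

/-! ### The black pebble game -/

section BlackGame

variable {V : Type*} [DecidableEq V]

/-- One move of the black pebble game: place a pebble on a vertex all of whose direct predecessors
carry pebbles, or remove any set of pebbles. -/
def BlackMove (G : Digraph V) (P P' : Finset V) : Prop :=
  (∃ v, P' = insert v P ∧ ∀ u, G.Adj u v → u ∈ P) ∨ P' ⊆ P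

/-- `P'` can be reached from `P` in the black pebble game with at most `k` pebbles. -/
def BlackReach (G : Digraph V) (k : ℕ) : Finset V → Finset V → Prop :=
  Relation.ReflTransGen (fun P P' => BlackMove G P P' ∧ P'.card ≤ k)

/-- All preconditions of spooky moves speak of pebbles only, so ghosts can be forgotten. This lets
lower bounds be proved in the black game. -/
theorem SpookyMove.blackMove {G : Digraph V} {P S P' S' : Finset V}
    (h : SpookyMove G P S P' S') : BlackMove G P P' := by
  obtain ⟨v, ⟨rfl, -, h⟩ | ⟨rfl, -, -⟩ | ⟨rfl, -⟩ | ⟨rfl, -, h⟩⟩ := h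
  · exact .inl ⟨v, by rw [Finset.union_comm, Finset.insert_eq], h⟩
  · exact .inr Finset.sdiff_subset
  · exact .inr Finset.sdiff_subset
  · exact .inl ⟨v, by rw [Finset.union_comm, Finset.insert_eq], h⟩

/-- The last time in `[t₀, t₁]` at which a predicate holds that holds at `t₀` but not at `t₁`. -/
theorem exists_last_time {p : ℕ → Prop} {t₀ t₁ : ℕ} (h : t₀ ≤ t₁) (h₀ : p t₀) (h₁ : ¬ p t₁) :
    ∃ τ, t₀ ≤ τ ∧ τ < t₁ ∧ p τ ∧ ∀ t, τ < t → t ≤ t₁ → ¬ p t := by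
  induction t₁, h using Nat.le_induction with
  | base => exact absurd h₀ h₁
  | succ n hn ih =>
    by_cases hp : p n
    · refine ⟨n, hn, n.lt_succ_self, hp, fun t ht ht' => ?_⟩
      rwa [show t = n + 1 by omega]
    · obtain ⟨τ, a, b, c, d⟩ := ih hp
      refine ⟨τ, a, by omega, c, fun t ht ht' => ?_⟩
      rcases Nat.lt_or_ge n t with h | h
      · rwa [show t = n + 1 by omega]
      · exact d t ht h

variable {G : Digraph V} {P : ℕ → Finset V}

/-- The last time at which a vertex is placed that is pebbled at `t₁` but not at `t₀`. -/
theorem exists_last_placement (hP : ∀ t, BlackMove G (P t) (P (t + 1))) {v : V} {t₀ t₁ : ℕ}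
    (h : t₀ ≤ t₁) (h₀ : v ∉ P t₀) (h₁ : v ∈ P t₁) :
    ∃ τ, t₀ ≤ τ ∧ τ < t₁ ∧ (∀ u, G.Adj u v → u ∈ P τ) ∧ ∀ t, τ < t → t ≤ t₁ → v ∈ P t := by
  obtain ⟨τ, a, b, c, d⟩ :=
    exists_last_time (p := fun t => v ∉ P t) h h₀ (not_not.mpr h₁)
  refine ⟨τ, a, b, ?_, fun t h h' => not_not.mp (d t h h')⟩
  have h2 : v ∈ P (τ + 1) := not_not.mp (d _ (by omega) (by omega))
  rcases hP τ with ⟨w, hw, hw'⟩ | hs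
  · rw [hw, Finset.mem_insert] at h2
    rcases h2 with rfl | h2
    · exact hw'
    · exact absurd h2 c
  · exact absurd (hs h2) c

/-! ### Blocking triangular grids -/

/-- A monotone lattice path in a triangular grid: `p l` is the first coordinate of its vertex in
row `l`. -/
def IsGridPath (p : ℕ → ℕ) : Prop := p 0 = 0 ∧ ∀ l, p (l + 1) = p l ∨ p (l + 1) = p l + 1

theorem IsGridPath.le {p : ℕ → ℕ} (hp : IsGridPath p) (l : ℕ) : p l ≤ l := by
  induction l with
  | zero => exact hp.1.le
  | succ l ih => rcases hp.2 l with h | h <;> omega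

/-- Some path from row `r - 1` to row `1` of the grid `φ` is free of pebbles, and so is `F`. -/
def GridOpen (φ : ℕ → ℕ → V) (r : ℕ) (F : Set V) (P : Finset V) : Prop :=
  (∃ p, IsGridPath p ∧ ∀ l, 0 < l → l < r → φ (p l) (l - p l) ∉ P) ∧ ∀ x ∈ F, x ∉ P

/-- The rows `1, …, r - 1` of a triangular grid. -/
def gridCells (φ : ℕ → ℕ → V) (r : ℕ) : Finset V :=
  ((Finset.range r ×ˢ Finset.range r).filter (fun c => 0 < c.1 + c.2 ∧ c.1 + c.2 < r)).image
    (fun c => φ c.1 c.2)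

theorem mem_gridCells {φ : ℕ → ℕ → V} {r : ℕ} {x : V} :
    x ∈ gridCells φ r ↔ ∃ a b, 0 < a + b ∧ a + b < r ∧ x = φ a b := by
  simp only [gridCells, Finset.mem_image, Finset.mem_filter, Finset.mem_product, Finset.mem_range,
    Prod.exists]
  constructor
  · rintro ⟨a, b, ⟨-, h, h'⟩, rfl⟩
    exact ⟨a, b, h, h', rfl⟩
  · rintro ⟨a, b, h, h', rfl⟩
    exact ⟨a, b, ⟨⟨by omega, by omega⟩, h, h'⟩, rfl⟩

theorem GridOpen.of_forall_notMem {V : Type*} {φ : ℕ → ℕ → V} {r : ℕ} {F : Set V} {P : Finset V}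
    (h : ∀ a b, 0 < a + b → a + b < r → φ a b ∉ P) (hF : ∀ x ∈ F, x ∉ P) :
    GridOpen φ r F P :=
  ⟨⟨fun _ => 0, ⟨rfl, fun _ => .inl rfl⟩, fun l hl hl' => h 0 l (by omega) (by omega)⟩, hF⟩

theorem exists_mem_of_not_gridOpen {φ : ℕ → ℕ → V} {r : ℕ} {F : Set V} {P : Finset V}
    (h : ¬ GridOpen φ r F P) : ∃ x ∈ P, x ∈ gridCells φ r ∨ x ∈ F := by
  by_contra hc
  push Not at hc
  refine h (.of_forall_notMem (fun a b h1 h2 hm => ?_) fun x hx hm => (hc x hm).2 hx)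
  exact (hc _ hm).1 (mem_gridCells.mpr ⟨a, b, h1, h2, rfl⟩)

/-- A triangular grid with `r` sources in a digraph. -/
structure IsGrid (G : Digraph V) (φ : ℕ → ℕ → V) (r : ℕ) : Prop where
  inj : ∀ a b a' b', a + b < r → a' + b' < r → φ a b = φ a' b' → a = a' ∧ b = b'
  adj_left : ∀ a b, a + b + 1 < r → G.Adj (φ (a + 1) b) (φ a b)
  adj_right : ∀ a b, a + b + 1 < r → G.Adj (φ a (b + 1)) (φ a b)

/-- When the last free path through a grid is blocked, a source has been placed, and the grid
carries as many pebbles as it has sources. -/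
theorem IsGrid.card_of_block {φ : ℕ → ℕ → V} {r : ℕ} {F : Set V} (hφ : IsGrid G φ r)
    (hF : ∀ v ∈ F, (∃ u ∈ F, G.Adj u v) ∨ (G.Adj (φ 0 1) v ∧ G.Adj (φ 1 0) v)) (hr : 2 ≤ r)
    {Q Q' : Finset V} (hm : BlackMove G Q Q') (ho : GridOpen φ r F Q) (hc : ¬ GridOpen φ r F Q') :
    (∀ x ∈ F, x ∉ Q') ∧ (∃ a < r, Q' = insert (φ a (r - 1 - a)) Q ∧
      ∀ u, G.Adj u (φ a (r - 1 - a)) → u ∈ Q) ∧ r ≤ (Q' ∩ gridCells φ r).card := by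
  obtain ⟨⟨p, hp, hpo⟩, hFo⟩ := ho
  rcases hm with ⟨v, rfl, hv⟩ | hs
  swap
  · exact absurd ⟨⟨p, hp, fun l h h' hm => hpo l h h' (hs hm)⟩, fun x hx hm => hFo x hx (hs hm)⟩ hc
  -- An element of `F` has an unpebbled predecessor: one in `F`, or the vertex of `p` in row 1,
  -- which is one of the only two vertices in that row.
  have hvF : v ∉ F := by
    intro h
    rcases hF v h with ⟨u, hu, hu'⟩ | ⟨h1, h2⟩
    · exact hFo u hu (hv u hu')
    · have := hpo 1 (by omega) (by omega)
      rcases hp.2 0 with h | h <;> rw [hp.1] at h <;> simp only [zero_add] at h <;> rw [h] at this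
      · exact this (hv _ h1)
      · exact this (hv _ h2)
  have hF' : ∀ x ∈ F, x ∉ insert v Q := by
    intro x hx hm
    rcases Finset.mem_insert.mp hm with rfl | hm
    · exact hvF hx
    · exact hFo x hx hm
  have hblock : ∀ p', IsGridPath p' → ∃ l, 0 < l ∧ l < r ∧ φ (p' l) (l - p' l) ∈ insert v Q := by
    intro p' hp'
    by_contra hcon
    push Not at hcon
    exact hc ⟨⟨p', hp', hcon⟩, hF'⟩
  have hple := hp.le
  -- The move blocks `p`, so the new pebble is on `p`. Above the last row this is impossible, since
  -- the next vertex of `p` is an unpebbled predecessor.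
  have hvp : v = φ (p (r - 1)) (r - 1 - p (r - 1)) := by
    obtain ⟨l, hl, hl', hm⟩ := hblock p hp
    have hlv : φ (p l) (l - p l) = v :=
      (Finset.mem_insert.mp hm).resolve_right (hpo l hl hl')
    rcases Nat.lt_or_ge (l + 1) r with h | h
    · exfalso
      refine hpo (l + 1) (by omega) h (hv _ ?_)
      have := hple l
      rw [← hlv]
      rcases hp.2 l with h2 | h2 <;> rw [h2]
      · rw [show l + 1 - p l = l - p l + 1 by omega]
        exact hφ.adj_right _ _ (by omega)
      · rw [show l + 1 - (p l + 1) = l - p l by omega]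
        exact hφ.adj_left _ _ (by omega)
    · rw [← hlv, show r - 1 = l by omega]
  have hpr := hple (r - 1)
  refine ⟨hF', ⟨p (r - 1), by omega, by rw [← hvp], by rwa [← hvp]⟩, ?_⟩
  -- every other source has a path that joins `p` only at the top
  have key : ∀ c, c < r → ∃ l a, 0 < l ∧ l < r ∧ a ≤ l ∧ φ a (l - a) ∈ insert v Q ∧
      ((c < p (r - 1) ∧ a = c ∧ c < p l) ∨ (c = p (r - 1) ∧ a = p l) ∨
        (p (r - 1) < c ∧ a + (r - 1 - c) = l ∧ p l < a)) := by
    intro c hcr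
    rcases Nat.lt_trichotomy c (p (r - 1)) with h | h | h
    -- From the source `c` this path keeps the first coordinate `c` until it meets `p`, and then
    -- follows `p`. The part on `p` is free, so it is blocked strictly on one side of `p`.
    · obtain ⟨l, hl, hl', hm⟩ := hblock (fun l => min (p l) c)
        ⟨by simp [hp.1], fun l => by have := hp.2 l; simp only; omega⟩
      have h1 := hple l
      refine ⟨l, min (p l) c, hl, hl', by omega, hm, .inl ⟨h, ?_⟩⟩
      by_contra hcon
      have h2 : min (p l) c = p l := by omega
      simp only [h2] at hm
      have h3 := (Finset.mem_insert.mp hm).resolve_right (hpo l hl hl')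
      rw [hvp] at h3
      have h4 := hφ.inj _ _ _ _ (by omega) (by omega) h3
      have h5 : l = r - 1 := by omega
      subst h5
      omega
    · exact ⟨r - 1, c, by omega, by omega, by omega, by rw [hvp, h]; simp, .inr (.inl ⟨h, h⟩)⟩
    -- The mirror image: the second coordinate `r - 1 - c` is kept until the path meets `p`.
    · obtain ⟨l, hl, hl', hm⟩ := hblock (fun l => max (p l) (l - (r - 1 - c)))
        ⟨by simp [hp.1], fun l => by have := hp.2 l; have := hple l; simp only; omega⟩
      have h1 := hple l
      refine ⟨l, max (p l) (l - (r - 1 - c)), hl, hl', by omega, hm, .inr (.inr ⟨h, ?_⟩)⟩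
      by_contra hcon
      have h2 : max (p l) (l - (r - 1 - c)) = p l := by omega
      simp only [h2] at hm
      have h3 := (Finset.mem_insert.mp hm).resolve_right (hpo l hl hl')
      rw [hvp] at h3
      have h4 := hφ.inj _ _ _ _ (by omega) (by omega) h3
      have h5 : l = r - 1 := by omega
      subst h5
      omega
  choose! l a h1 h2 h3 h4 h5 using key
  calc r = (Finset.range r).card := by simp
    _ ≤ _ := by
      refine Finset.card_le_card_of_injOn (fun c => φ (a c) (l c - a c)) ?_ ?_
      · intro c hc
        have hc' : c < r := by simpa using hc
        have := h1 c hc'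
        have := h2 c hc'
        have := h3 c hc'
        refine Finset.mem_coe.mpr (Finset.mem_inter.mpr ⟨h4 c hc', ?_⟩)
        exact mem_gridCells.mpr ⟨_, _, by omega, by omega, rfl⟩
      -- The straight segments on one side of `p` are parallel, and the two sides are disjoint from
      -- each other and from `p`; so different sources give different pebbles.
      · intro c hc c' hc' he
        have hc : c < r := by simpa using hc
        have hc' : c' < r := by simpa using hc'
        have := h2 c hc
        have := h3 c hc
        have := h2 c' hc'
        have := h3 c' hc'
        have h6 := hφ.inj _ _ _ _ (by omega) (by omega) he
        have h7 : l c = l c' := by omega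
        have h8 := h5 c hc
        have h9 := h5 c' hc'
        rw [← h7] at h9
        omega

/-- If a grid is open at `t₀` but not at `t₁`, then there is a last time at which it is open, and
right after this time it carries many pebbles. -/
theorem IsGrid.exists_last_fill {φ : ℕ → ℕ → V} {r : ℕ} {F : Set V} (hφ : IsGrid G φ r)
    (hF : ∀ v ∈ F, (∃ u ∈ F, G.Adj u v) ∨ (G.Adj (φ 0 1) v ∧ G.Adj (φ 1 0) v)) (hr : 2 ≤ r)
    (hP : ∀ t, BlackMove G (P t) (P (t + 1))) {t₀ t₁ : ℕ} (h : t₀ ≤ t₁)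
    (ho : GridOpen φ r F (P t₀)) (hc : ¬ GridOpen φ r F (P t₁)) :
    ∃ τ, t₀ ≤ τ ∧ τ < t₁ ∧ GridOpen φ r F (P τ) ∧ (∀ t, τ < t → t ≤ t₁ → ¬ GridOpen φ r F (P t)) ∧
      (∀ x ∈ F, x ∉ P (τ + 1)) ∧ (∃ a < r, P (τ + 1) = insert (φ a (r - 1 - a)) (P τ) ∧
      ∀ u, G.Adj u (φ a (r - 1 - a)) → u ∈ P τ) ∧ r ≤ (P (τ + 1) ∩ gridCells φ r).card := by
  obtain ⟨τ, a, b, c, d⟩ := exists_last_time (p := fun t => GridOpen φ r F (P t)) h ho hc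
  exact ⟨τ, a, b, c, d, hφ.card_of_block hF hr (hP τ) c (d _ (by omega) (by omega))⟩

/-! Reachability -/

theorem BlackReach.trans {k : ℕ} {P Q R : Finset V} (h : BlackReach G k P Q)
    (h' : BlackReach G k Q R) : BlackReach G k P R :=
  Relation.ReflTransGen.trans h h'

theorem BlackReach.place {k : ℕ} {P : Finset V} {v : V} (h : ∀ u, G.Adj u v → u ∈ P)
    (hk : P.card + 1 ≤ k) : BlackReach G k P (insert v P) :=
  .single ⟨.inl ⟨v, rfl, h⟩, (Finset.card_insert_le _ _).trans hk⟩

theorem BlackReach.drop {k : ℕ} {P P' : Finset V} (h : P' ⊆ P) (hk : P'.card ≤ k) :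
    BlackReach G k P P' :=
  .single ⟨.inr h, hk⟩

/-- A strategy can be played while the pebbles of `H` stand aside. Disjointness is not needed, since
cardinalities are only bounded from above. -/
theorem BlackReach.frame {k r : ℕ} {P P' : Finset V} (h : BlackReach G r P P') (H : Finset V)
    (hk : r + H.card ≤ k) : BlackReach G k (P ∪ H) (P' ∪ H) := by
  refine Relation.ReflTransGen.lift (fun P => P ∪ H) ?_ _ _ h
  rintro P P' ⟨⟨v, rfl, hv⟩ | hs, hc⟩
  · exact ⟨.inl ⟨v, Finset.insert_union _ _ _, fun u hu => Finset.mem_union_left _ (hv u hu)⟩,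
      (Finset.card_union_le _ _).trans (by omega)⟩
  · exact ⟨.inr (Finset.union_subset_union_left hs), (Finset.card_union_le _ _).trans (by omega)⟩

theorem BlackReach.mono {k r : ℕ} {P P' : Finset V} (h : BlackReach G r P P') (hk : r ≤ k) :
    BlackReach G k P P' := by
  simpa using h.frame ∅ (by simpa using hk)

/-- Place pebbles on a set of vertices that can be pebbled in one move each. -/
theorem BlackReach.place_all {k : ℕ} {P : Finset V} (W : Finset V)
    (h : ∀ w ∈ W, w ∈ P ∨ ∀ u, G.Adj u w → u ∈ P) (hk : P.card + W.card ≤ k) :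
    BlackReach G k P (W ∪ P) := by
  induction W using Finset.induction_on with
  | empty => rw [Finset.empty_union]; exact .refl
  | insert w W hw ih =>
    rw [Finset.card_insert_of_notMem hw] at hk
    refine (ih (fun w hw => h w (Finset.mem_insert_of_mem hw)) (by omega)).trans ?_
    rw [Finset.insert_union]
    rcases h w (Finset.mem_insert_self _ _) with h' | h'
    · rw [Finset.insert_eq_of_mem (Finset.mem_union_right _ h')]; exact .refl
    · have := Finset.card_union_le W P
      exact .place (fun u hu => Finset.mem_union_right _ (h' u hu)) (by omega)

end BlackGame

/-! ### Truth of a quantified formula, variable by variable -/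

section Truth

variable {N : ℕ}

/-- Truth of `Qᵢ xᵢ … F` under an assignment of the variables before `xᵢ`. The other values of the
assignment do not matter. -/
def TrueFrom (Q : Fin N → Quantifier) (F : (Fin N → Bool) → Prop) (i : ℕ) (σ : Fin N → Bool) :
    Prop :=
  if h : i < N then
    match Q ⟨i, h⟩ with
    | .all => ∀ b, TrueFrom Q F (i + 1) (Function.update σ ⟨i, h⟩ b)
    | .ex => ∃ b, TrueFrom Q F (i + 1) (Function.update σ ⟨i, h⟩ b)
  else F σ
termination_by N - i

variable {Q : Fin N → Quantifier} {F : (Fin N → Bool) → Prop} {i : ℕ} {σ : Fin N → Bool}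

theorem trueFrom_of_le (h : N ≤ i) : TrueFrom Q F i σ ↔ F σ := by
  rw [TrueFrom, dif_neg (by omega)]

theorem trueFrom_all (h : i < N) (hQ : Q ⟨i, h⟩ = .all) :
    TrueFrom Q F i σ ↔ ∀ b, TrueFrom Q F (i + 1) (Function.update σ ⟨i, h⟩ b) := by
  conv_lhs => rw [TrueFrom, dif_pos h, hQ]

theorem trueFrom_ex (h : i < N) (hQ : Q ⟨i, h⟩ = .ex) :
    TrueFrom Q F i σ ↔ ∃ b, TrueFrom Q F (i + 1) (Function.update σ ⟨i, h⟩ b) := by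
  conv_lhs => rw [TrueFrom, dif_pos h, hQ]

/-- `QuantTrue` renumbers the remaining variables at every quantifier, while `TrueFrom` updates one
assignment of all `N` variables. The two agree when the `d` remaining values are glued to the first
`i` values of `σ`. -/
theorem trueFrom_iff_quantTrue (d : ℕ) : ∀ (i : ℕ) (hd : i + d = N) (σ : Fin N → Bool),
    TrueFrom Q F i σ ↔ QuantTrue d (fun j => Q ⟨i + j, by omega⟩)
      (fun τ => F (fun j => if h : j.val < i then σ j else τ ⟨j.val - i, by omega⟩)) := by
  induction d with
  | zero =>
    intro i hd σ
    rw [trueFrom_of_le (by omega), QuantTrue]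
    refine iff_of_eq (congrArg F (funext fun j => ?_))
    rw [dif_pos (by omega)]
  | succ d ih =>
    intro i hd σ
    have hi : i < N := by omega
    have key : ∀ b, TrueFrom Q F (i + 1) (Function.update σ ⟨i, hi⟩ b) ↔
        QuantTrue d (fun j => Q ⟨i + (j.succ : Fin (d + 1)), by omega⟩)
        (fun τ => F (fun j => if h : j.val < i then σ j else
          (Fin.cons b τ : Fin (d + 1) → Bool) ⟨j.val - i, by omega⟩)) := by
      intro b
      rw [ih (i + 1) (by omega)]
      have e : (fun j : Fin d => Q ⟨i + 1 + j, by omega⟩) =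
          fun j : Fin d => Q ⟨i + (j.succ : Fin (d + 1)), by omega⟩ := by
        funext j
        congr 2
        simp
        omega
      rw [e]
      refine iff_of_eq (congrArg _ (funext fun τ => congrArg F (funext fun j => ?_)))
      rcases Nat.lt_trichotomy j.val i with h | h | h
      · rw [dif_pos (by omega), dif_pos h, Function.update_of_ne]
        rintro rfl
        simp at h
      · have : j = ⟨i, hi⟩ := Fin.ext h
        subst this
        simp
      · rw [dif_neg (by omega), dif_neg (by omega)]
        have : (⟨j.val - i, by omega⟩ : Fin (d + 1)) = Fin.succ ⟨j.val - (i + 1), by omega⟩ := by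
          ext
          simp
          omega
        rw [this, Fin.cons_succ]
    rw [QuantTrue]
    simp only [← key, Fin.val_zero, add_zero]
    rcases hQ : Q ⟨i, hi⟩ with _ | _
    · rw [trueFrom_all hi hQ]
    · rw [trueFrom_ex hi hQ]

theorem quantTrue_iff_trueFrom (σ : Fin N → Bool) : QuantTrue N Q F ↔ TrueFrom Q F 0 σ := by
  rw [trueFrom_iff_quantTrue N 0 (by omega)]
  simp

/-- Innermost existential quantifiers ask for an extension of the assignment. -/
theorem trueFrom_iff_exists (i : ℕ) (σ : Fin N → Bool) (hi : ∀ j : Fin N, i ≤ j.val → Q j = .ex) :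
    TrueFrom Q F i σ ↔ ∃ τ, (∀ j : Fin N, j.val < i → τ j = σ j) ∧ F τ := by
  rcases Nat.lt_or_ge i N with h | h
  · rw [trueFrom_ex h (hi _ le_rfl)]
    have ih : ∀ b, TrueFrom Q F (i + 1) (Function.update σ ⟨i, h⟩ b) ↔ _ := fun b =>
      trueFrom_iff_exists (i + 1) _ fun j hj => hi j (by omega)
    simp only [ih]
    constructor
    · rintro ⟨b, τ, h1, h2⟩
      refine ⟨τ, fun j hj => ?_, h2⟩
      rw [h1 j (by omega), Function.update_of_ne]
      rintro rfl
      simp at hj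
    · rintro ⟨τ, h1, h2⟩
      refine ⟨τ ⟨i, h⟩, τ, fun j hj => ?_, h2⟩
      rcases eq_or_ne j ⟨i, h⟩ with rfl | hne
      · simp
      · rw [Function.update_of_ne hne]
        exact h1 j (by have : j.val ≠ i := fun e => hne (Fin.ext e); omega)
  · rw [trueFrom_of_le h]
    constructor
    · exact fun hF => ⟨σ, fun _ _ => rfl, hF⟩
    · rintro ⟨τ, h1, h2⟩
      rwa [show σ = τ from funext fun j => (h1 j (by omega)).symm]
termination_by N - i

/-- Innermost existential quantifiers can be moved into the matrix. -/
theorem trueFrom_append {n a : ℕ} {Q : Fin n → Quantifier} {F : (Fin (n + a) → Bool) → Prop} :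
    ∀ (d i : ℕ) (_ : i + d = n) (σ : Fin (n + a) → Bool),
    TrueFrom (Fin.append Q fun _ => .ex) F i σ ↔
      TrueFrom Q (fun σ => ∃ τ, F (Fin.append σ τ)) i (fun j => σ (j.castAdd a)) := by
  intro d
  induction d with
  | zero =>
    intro i hi σ
    rw [trueFrom_of_le (N := n) (by omega), trueFrom_iff_exists]
    · constructor
      · rintro ⟨τ, h1, h2⟩
        refine ⟨fun j => τ (j.natAdd n), ?_⟩
        convert h2 using 1
        funext j
        refine Fin.addCases (fun j => ?_) (fun j => ?_) j
        · rw [Fin.append_left, h1 _ (by simp; omega)]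
        · rw [Fin.append_right]
      · rintro ⟨τ, h⟩
        refine ⟨_, fun j hj => ?_, h⟩
        obtain ⟨j, rfl⟩ : ∃ k : Fin n, j = k.castAdd a := ⟨⟨j, by omega⟩, rfl⟩
        rw [Fin.append_left]
    · intro j hj
      obtain ⟨j, rfl⟩ : ∃ k : Fin a, j = k.natAdd n := ⟨⟨j - n, by omega⟩, by ext; simp; omega⟩
      rw [Fin.append_right]
  | succ d ih =>
    intro i hi σ
    have h : i < n := by omega
    have h' : i < n + a := by omega
    have hQ : Fin.append Q (fun _ : Fin a => Quantifier.ex) ⟨i, h'⟩ = Q ⟨i, h⟩ :=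
      Fin.append_left (n := a) Q (fun _ => Quantifier.ex) ⟨i, h⟩
    have key : ∀ b, (fun j : Fin n => Function.update σ ⟨i, h'⟩ b (j.castAdd a)) =
        Function.update (fun j => σ (j.castAdd a)) ⟨i, h⟩ b := by
      intro b
      funext j
      simp only [Function.update_apply, Fin.ext_iff, Fin.val_castAdd]
    rcases hq : Q ⟨i, h⟩ with _ | _
    · rw [trueFrom_all h' (hQ.trans hq), trueFrom_all h hq]
      simp only [ih (i + 1) (by omega), key]
    · rw [trueFrom_ex h' (hQ.trans hq), trueFrom_ex h hq]
      simp only [ih (i + 1) (by omega), key]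

end Truth

/-! ### Correctness of the clausal form -/

namespace BoolFormula

/-- An assignment satisfies a list of clauses. -/
def SatAll {N : ℕ} (ρ : Fin N → Bool) (L : List (Clause N)) : Prop :=
  ∀ c ∈ L, ∃ l ∈ c.1, ρ l.1 = l.2

/-- The values of the new variables. -/
def auxVal {n : ℕ} (σ : Fin n → Bool) : (φ : BoolFormula n) → Fin φ.auxCount → Bool
  | const b => fun _ => b
  | var _ => Fin.elim0
  | neg φ => φ.auxVal σ
  | and φ ψ => Fin.snoc (Fin.append (φ.auxVal σ) (ψ.auxVal σ)) ((and φ ψ).eval σ)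
  | or φ ψ => Fin.snoc (Fin.append (φ.auxVal σ) (ψ.auxVal σ)) ((or φ ψ).eval σ)

variable {n N : ℕ}

theorem sat_clause_of {ρ : Fin N → Bool} {a b c : Literal N} :
    (∃ l ∈ (Clause.of a b c).1, ρ l.1 = l.2) ↔ ρ a.1 = a.2 ∨ ρ b.1 = b.2 ∨ ρ c.1 = c.2 := by
  simp [Clause.of]

theorem satAll_cons {ρ : Fin N → Bool} {c : Clause N} {L : List (Clause N)} :
    SatAll ρ (c :: L) ↔ (∃ l ∈ c.1, ρ l.1 = l.2) ∧ SatAll ρ L := by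
  simp [SatAll]

theorem satAll_append {ρ : Fin N → Bool} {L L' : List (Clause N)} :
    SatAll ρ (L ++ L') ↔ SatAll ρ L ∧ SatAll ρ L' := by
  simp [SatAll, or_imp, forall_and]

theorem sat_not {ρ : Fin N → Bool} {l : Literal N} : ρ l.not.1 = l.not.2 ↔ ¬ ρ l.1 = l.2 := by
  simp only [Literal.not]
  cases ρ l.1 <;> cases l.2 <;> decide

/-- The clauses of a gate force its variable to equal the gate. Both directions are needed because
negation has no variable of its own and just flips the literal. -/
theorem tseitin_sound (x : Fin n → Fin N) (ρ : Fin N → Bool) :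
    ∀ (φ : BoolFormula n) (y : Fin φ.auxCount → Fin N), SatAll ρ (φ.tseitin x y).2 →
      (ρ (φ.tseitin x y).1.1 = (φ.tseitin x y).1.2 ↔ φ.eval (ρ ∘ x) = true) := by
  intro φ
  induction φ with
  | const b =>
    intro y h
    simp only [tseitin, satAll_cons, sat_clause_of, or_self, eval] at h ⊢
    rw [h.1]
  | var i => intro y _; simp [tseitin, eval]
  | neg φ ih =>
    intro y h
    simp only [tseitin] at h ⊢
    rw [sat_not, ih y h]
    simp [eval]
  | and φ ψ ih ih' =>
    intro y h
    simp only [tseitin, satAll_cons, satAll_append, sat_clause_of, sat_not] at h ⊢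
    obtain ⟨h1, h2, h3, h4, h5⟩ := h
    rw [ih _ h4] at h1 h3
    rw [ih' _ h5] at h2 h3
    simp only [eval, Bool.and_eq_true]
    tauto
  | or φ ψ ih ih' =>
    intro y h
    simp only [tseitin, satAll_cons, satAll_append, sat_clause_of, sat_not] at h ⊢
    obtain ⟨h1, h2, h3, h4, h5⟩ := h
    rw [ih _ h4] at h1 h3
    rw [ih' _ h5] at h2 h3
    simp only [eval, Bool.or_eq_true]
    tauto

/-- The values `auxVal` are those of the subformulas. Once the clauses of the two parts of a gate
hold, `tseitin_sound` evaluates their literals, and the clauses of the gate become a truth table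
check. -/
theorem tseitin_complete (x : Fin n → Fin N) (ρ : Fin N → Bool) :
    ∀ (φ : BoolFormula n) (y : Fin φ.auxCount → Fin N), (∀ j, ρ (y j) = φ.auxVal (ρ ∘ x) j) →
      SatAll ρ (φ.tseitin x y).2 := by
  intro φ
  induction φ with
  | const b =>
    intro y h
    simp only [tseitin, satAll_cons, sat_clause_of, or_self]
    exact ⟨h _, by simp [SatAll]⟩
  | var i => intro y _; simp [tseitin, SatAll]
  | neg φ ih => exact ih
  | and φ ψ ih ih' =>
    intro y h
    have h1 := ih (fun i => y (i.castAdd ψ.auxCount).castSucc) fun j =>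
      (h (Fin.castSucc (n := φ.auxCount + ψ.auxCount) _)).trans
        ((Fin.snoc_castSucc (α := fun _ => Bool) _ _ _).trans (Fin.append_left _ _ _))
    have h2 := ih' (fun i => y (i.natAdd φ.auxCount).castSucc) fun j =>
      (h (Fin.castSucc (n := φ.auxCount + ψ.auxCount) _)).trans
        ((Fin.snoc_castSucc (α := fun _ => Bool) _ _ _).trans (Fin.append_right _ _ _))
    have h3 := tseitin_sound x ρ _ _ h1
    have h4 := tseitin_sound x ρ _ _ h2
    have h5 := (h (Fin.last (φ.auxCount + ψ.auxCount))).trans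
      (Fin.snoc_last (α := fun _ => Bool) _ _)
    simp only [eval] at h5
    simp only [tseitin, satAll_cons, satAll_append, sat_clause_of, sat_not, h3, h4, h1, h2, h5]
    cases eval (ρ ∘ x) φ <;> cases eval (ρ ∘ x) ψ <;> simp
  | or φ ψ ih ih' =>
    intro y h
    have h1 := ih (fun i => y (i.castAdd ψ.auxCount).castSucc) fun j =>
      (h (Fin.castSucc (n := φ.auxCount + ψ.auxCount) _)).trans
        ((Fin.snoc_castSucc (α := fun _ => Bool) _ _ _).trans (Fin.append_left _ _ _))
    have h2 := ih' (fun i => y (i.natAdd φ.auxCount).castSucc) fun j =>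
      (h (Fin.castSucc (n := φ.auxCount + ψ.auxCount) _)).trans
        ((Fin.snoc_castSucc (α := fun _ => Bool) _ _ _).trans (Fin.append_right _ _ _))
    have h3 := tseitin_sound x ρ _ _ h1
    have h4 := tseitin_sound x ρ _ _ h2
    have h5 := (h (Fin.last (φ.auxCount + ψ.auxCount))).trans
      (Fin.snoc_last (α := fun _ => Bool) _ _)
    simp only [eval] at h5
    simp only [tseitin, satAll_cons, satAll_append, sat_clause_of, sat_not, h3, h4, h1, h2, h5]
    cases eval (ρ ∘ x) φ <;> cases eval (ρ ∘ x) ψ <;> simp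

theorem auxCount_le_size : ∀ φ : BoolFormula n, φ.auxCount ≤ φ.size := by
  intro φ
  induction φ <;> simp only [auxCount, size] <;> omega

theorem length_tseitin_le (x : Fin n → Fin N) :
    ∀ (φ : BoolFormula n) (y : Fin φ.auxCount → Fin N), (φ.tseitin x y).2.length ≤ 3 * φ.size := by
  intro φ
  induction φ with
  | const b => intro y; simp [tseitin, size]
  | var i => intro y; simp [tseitin, size]
  | neg φ ih => intro y; have := ih y; simp only [tseitin, size]; omega
  | and φ ψ ih ih' =>
    intro y
    have h1 := ih (fun i => y (i.castAdd ψ.auxCount).castSucc)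
    have h2 := ih' (fun i => y (i.natAdd φ.auxCount).castSucc)
    simp only [tseitin, size, List.length_cons, List.length_append]
    omega
  | or φ ψ ih ih' =>
    intro y
    have h1 := ih (fun i => y (i.castAdd ψ.auxCount).castSucc)
    have h2 := ih' (fun i => y (i.natAdd φ.auxCount).castSucc)
    simp only [tseitin, size, List.length_cons, List.length_append]
    omega

theorem size_pos (φ : BoolFormula n) : 0 < φ.size := by
  cases φ <;> simp [size]

end BoolFormula

open BoolFormula in
theorem QBF.toQCNF_isTrue (F : QBF) : F.toQCNF.IsTrue ↔ F.IsTrue := by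
  unfold QCNF.IsTrue QBF.IsTrue
  rw [quantTrue_iff_trueFrom (fun _ => false), quantTrue_iff_trueFrom (fun _ => false)]
  unfold QBF.toQCNF
  rw [trueFrom_append F.numVars 0 (by omega)]
  refine iff_of_eq (congrArg (fun M => TrueFrom F.quant M 0 _) (funext fun σ => propext ?_))
  constructor
  · rintro ⟨τ, h⟩
    have h' := satAll_cons.mp h
    rw [sat_clause_of, or_self, or_self] at h'
    have h2 := (tseitin_sound _ _ _ _ h'.2).mp h'.1
    convert h2 using 2
    funext j
    simp
  · intro h
    refine ⟨F.matrix.auxVal σ, ?_⟩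
    have e : Fin.append σ (F.matrix.auxVal σ) ∘ Fin.castAdd F.matrix.auxCount = σ := by
      funext j
      simp
    have h1 := tseitin_complete (Fin.castAdd F.matrix.auxCount) (Fin.append σ (F.matrix.auxVal σ))
      F.matrix (Fin.natAdd F.numVars) fun j => by rw [e]; simp
    refine satAll_cons.mpr ⟨?_, h1⟩
    rw [sat_clause_of, or_self, or_self, tseitin_sound _ _ _ _ h1, e]
    exact h

/-- There are at most as many new variables as nodes, and at most three clauses per node. The
additive constant 2 is absorbed because the matrix has a node. -/
theorem QBF.toQCNF_size_le (F : QBF) : F.toQCNF.size ≤ 6 * F.size := by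
  have h1 := F.matrix.auxCount_le_size
  have h2 := F.matrix.size_pos
  have h3 := BoolFormula.length_tseitin_le (Fin.castAdd F.matrix.auxCount) F.matrix
    (Fin.natAdd F.numVars)
  unfold QCNF.size QCNF.numClauses QBF.toQCNF QBF.size
  simp only [List.length_cons]
  omega

/-! ### The structure of the graph -/

theorem Digraph.IsAcyclic.of_rank {V : Type*} {G : Digraph V} (f : V → ℕ)
    (h : ∀ u v, G.Adj u v → f u < f v) : G.IsAcyclic := by
  intro v hv
  have key : ∀ u w, Relation.TransGen G.Adj u w → f u < f w := by
    intro u w huw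
    induction huw with
    | single h' => exact h _ _ h'
    | tail _ h' ih => exact ih.trans (h _ _ h')
  exact lt_irrefl _ (key v v hv)

namespace QCNF

variable {Φ : QCNF}

theorem adj_pyr_iff {i : Fin Φ.numVars} {r : Fin 3} {v : PyramidVertex (Φ.pyramidSize i r)}
    {u : Φ.Vertex} : Φ.gltGraph.Adj u (.pyr i r v) ↔ ∃ w, w.Adj v ∧ u = .pyr i r w := Iff.rfl

theorem adj_lit_iff {i : Fin Φ.numVars} {b : Bool} {u : Φ.Vertex} :
    Φ.gltGraph.Adj u (.lit i b) ↔ u = Φ.belowLit i b := Iff.rfl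

theorem adj_bar_iff {i : Fin Φ.numVars} {h : Φ.quant i = .ex} {u : Φ.Vertex} :
    Φ.gltGraph.Adj u (.bar i h) ↔ u = Φ.apex i 0 ∨ u = Φ.apex i 2 := Iff.rfl

theorem adj_wit_ex_iff {i : Fin Φ.numVars} (h : Φ.quant i = .ex) {u : Φ.Vertex} :
    Φ.gltGraph.Adj u (.wit i) ↔
      u = Φ.outFrom (i.val + 1) ∨ u = Φ.apex i 1 ∨ u = .lit i true ∨ u = .lit i false := by
  simp only [gltGraph, preds, h]
  rfl

theorem adj_wit_all_iff {i : Fin Φ.numVars} (h : Φ.quant i = .all) {u : Φ.Vertex} :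
    Φ.gltGraph.Adj u (.wit i) ↔
      u = Φ.outFrom (i.val + 1) ∨ u = Φ.apex i 1 ∨ u = .lit i true ∨ u = Φ.apex i 0 := by
  simp only [gltGraph, preds, h, belowLit, reduceCtorEq, dite_false]
  rfl

theorem belowLit_ex_true {i : Fin Φ.numVars} (h : Φ.quant i = .ex) :
    Φ.belowLit i true = Φ.apex i 0 := by
  simp [belowLit, h]

theorem belowLit_ex_false {i : Fin Φ.numVars} (h : Φ.quant i = .ex) :
    Φ.belowLit i false = .bar i h := by
  simp [belowLit, h]

theorem belowLit_all_true {i : Fin Φ.numVars} (h : Φ.quant i = .all) :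
    Φ.belowLit i true = Φ.apex i 2 := by
  simp [belowLit, h]

theorem belowLit_all_false {i : Fin Φ.numVars} (h : Φ.quant i = .all) :
    Φ.belowLit i false = Φ.apex i 0 := by
  simp [belowLit, h]

theorem adj_out_ex_iff {i : Fin Φ.numVars} (h : Φ.quant i = .ex) {u : Φ.Vertex} :
    Φ.gltGraph.Adj u (.out i) ↔ u = .wit i ∨ u = .bar i h := by
  rw [← belowLit_ex_false h]
  simp only [gltGraph, preds, h]
  rfl

theorem adj_out_all_iff {i : Fin Φ.numVars} (h : Φ.quant i = .all) {u : Φ.Vertex} :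
    Φ.gltGraph.Adj u (.out i) ↔
      u = Φ.outFrom (i.val + 1) ∨ u = .wit i ∨ u = Φ.apex i 2 ∨ u = .lit i false := by
  rw [← belowLit_all_true h]
  simp only [gltGraph, preds, h]
  rfl

theorem adj_chk_iff {c : Fin Φ.numClauses} {u : Φ.Vertex} :
    Φ.gltGraph.Adj u (.chk c.succ) ↔ u = .chk c.castSucc ∨
      (∃ l ∈ (Φ.clauses.get c).1, u = .lit l.1 l.2) ∨ ∃ k, u = .pad c k := by
  constructor
  · rintro ⟨c', hc, h⟩
    obtain rfl := Fin.succ_injective _ hc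
    exact h
  · exact fun h => ⟨c, rfl, h⟩

theorem not_adj_chk_zero {u : Φ.Vertex} : ¬ Φ.gltGraph.Adj u (.chk 0) := by
  rintro ⟨c, hc, -⟩
  exact Fin.succ_ne_zero c hc.symm

theorem not_adj_pad {c : Fin Φ.numClauses} {k : Fin (3 - (Φ.clauses.get c).1.card)}
    {u : Φ.Vertex} : ¬ Φ.gltGraph.Adj u (.pad c k) := fun h => h

theorem outFrom_of_lt {i : ℕ} (h : i < Φ.numVars) : Φ.outFrom i = .out ⟨i, h⟩ := dif_pos h

theorem outFrom_of_le {i : ℕ} (h : Φ.numVars ≤ i) : Φ.outFrom i = .chk (Fin.last _) :=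
  dif_neg (by omega)

/-! Acyclicity -/

/-- A rank that increases along the edges. -/
def rank : Φ.Vertex → ℕ
  | .pyr i r v => Φ.pyramidSize i r - (v.1.1.val + v.1.2.val)
  | .bar _ _ => 3 * Φ.numVars + 4
  | .lit _ _ => 3 * Φ.numVars + 5
  | .pad _ _ => 0
  | .chk j => 3 * Φ.numVars + 6 + j
  | .wit i => 3 * Φ.numVars + 6 + Φ.numClauses + 2 * (Φ.numVars - i)
  | .out i => 3 * Φ.numVars + 7 + Φ.numClauses + 2 * (Φ.numVars - i)

theorem rank_apex (i : Fin Φ.numVars) (r : Fin 3) : rank (Φ.apex i r) ≤ 3 * Φ.numVars + 3 := by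
  simp only [rank, apex, pyramidSize]
  omega

theorem rank_belowLit (i : Fin Φ.numVars) (b : Bool) :
    rank (Φ.belowLit i b) ≤ 3 * Φ.numVars + 4 := by
  have h0 := rank_apex i 0
  have h2 := rank_apex i 2
  unfold belowLit
  split_ifs
  · omega
  · exact le_rfl
  · omega
  · omega

theorem rank_outFrom (i : Fin Φ.numVars) :
    rank (Φ.outFrom (i.val + 1)) < 3 * Φ.numVars + 6 + Φ.numClauses + 2 * (Φ.numVars - i) := by
  unfold outFrom
  split_ifs with h
  · simp only [rank]
    omega
  · simp only [rank, Fin.val_last]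
    omega

theorem rank_lt_of_adj {u v : Φ.Vertex} (h : Φ.gltGraph.Adj u v) : rank u < rank v := by
  rcases v with ⟨i, r, v⟩ | ⟨i, b⟩ | ⟨i, hi⟩ | i | i | j | ⟨j, k⟩
  · obtain ⟨w, hw, rfl⟩ := adj_pyr_iff.mp h
    have := w.2
    have := v.2
    simp only [rank]
    rcases hw with ⟨h1, h2⟩ | ⟨h1, h2⟩ <;> rw [Fin.ext_iff] at * <;> omega
  · rw [adj_lit_iff] at h
    subst h
    exact Nat.lt_succ_of_le (rank_belowLit i b)
  · have h0 := rank_apex i 0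
    have h2 := rank_apex i 2
    rcases adj_bar_iff.mp h with rfl | rfl <;> simp only [rank] at * <;> omega
  · have h0 := rank_apex i 0
    have h1 := rank_apex i 1
    have h3 := rank_outFrom i
    rcases hq : Φ.quant i with _ | _
    · rcases (adj_wit_all_iff hq).mp h with rfl | rfl | rfl | rfl <;> simp only [rank] at * <;> omega
    · rcases (adj_wit_ex_iff hq).mp h with rfl | rfl | rfl | rfl <;> simp only [rank] at * <;> omega
  · have h2 := rank_apex i 2
    have h3 := rank_outFrom i
    rcases hq : Φ.quant i with _ | _
    · rcases (adj_out_all_iff hq).mp h with rfl | rfl | rfl | rfl <;> simp only [rank] at * <;> omega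
    · rcases (adj_out_ex_iff hq).mp h with rfl | rfl <;> simp only [rank] at * <;> omega
  · obtain ⟨c, rfl, rfl | ⟨l, -, rfl⟩ | ⟨k, rfl⟩⟩ := h <;>
      simp only [rank, Fin.val_succ, Fin.val_castSucc] <;> omega
  · exact absurd h not_adj_pad

theorem rank_le (v : Φ.Vertex) :
    rank v ≤ 3 * Φ.numVars + 7 + Φ.numClauses + 2 * Φ.numVars := by
  rcases v with ⟨i, r, v⟩ | ⟨i, b⟩ | ⟨i, hi⟩ | i | i | j | ⟨j, k⟩ <;>
    (simp only [rank, pyramidSize]; omega)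

/-- A rank on the graph with the diamond that increases along the edges. -/
def spookyRank : Φ.SpookyVertex → ℕ :=
  Sum.elim rank fun v =>
    3 * Φ.numVars + 7 + Φ.numClauses + 2 * Φ.numVars + (v.1.1.val + v.1.2.val)

theorem spookyRank_lt_of_adj {u v : Φ.SpookyVertex} (h : Φ.spookyGraph.Adj u v) :
    spookyRank u < spookyRank v := by
  rcases u with u | u <;> rcases v with v | v
  · exact rank_lt_of_adj h
  · have h1 := rank_le u
    have h2 := v.2
    simp only [spookyRank, Sum.elim_inl, Sum.elim_inr]
    omega
  · exact h.elim
  · simp only [spookyRank, Sum.elim_inr]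
    rcases h with ⟨h1, h2⟩ | ⟨h1, h2⟩ <;> rw [Fin.ext_iff] at * <;> omega

/-! Every vertex lies below the output -/

theorem apex_reaches {i : Fin Φ.numVars} {r : Fin 3} (a b : ℕ)
    (ha : a < Φ.pyramidSize i r) (hb : b < Φ.pyramidSize i r) (h : a + b < Φ.pyramidSize i r) :
    Relation.ReflTransGen Φ.gltGraph.Adj (.pyr i r ⟨(⟨a, ha⟩, ⟨b, hb⟩), h⟩) (Φ.apex i r) := by
  induction a with
  | succ a ih =>
    refine .head ?_ (ih (by omega) (by omega))
    exact adj_pyr_iff.mpr ⟨⟨(⟨a + 1, ha⟩, ⟨b, hb⟩), h⟩, .inl ⟨rfl, rfl⟩, rfl⟩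
  | zero =>
    induction b with
    | succ b ih =>
      refine .head ?_ (ih (by omega) (by omega))
      exact adj_pyr_iff.mpr ⟨⟨(⟨0, ha⟩, ⟨b + 1, hb⟩), h⟩, .inr ⟨rfl, rfl⟩, rfl⟩
    | zero => exact .refl

theorem wit_reaches_out (i : Fin Φ.numVars) : Φ.gltGraph.Adj (.wit i) (.out i) := by
  rcases hq : Φ.quant i with _ | _
  · exact (adj_out_all_iff hq).mpr (by simp)
  · exact (adj_out_ex_iff hq).mpr (by simp)

theorem outFrom_reaches (i : ℕ) (hi : i ≤ Φ.numVars) :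
    Relation.ReflTransGen Φ.gltGraph.Adj (Φ.outFrom i) (Φ.outFrom 0) := by
  induction i with
  | zero => exact .refl
  | succ i ih =>
    refine .head (b := .wit ⟨i, hi⟩) ?_ (.head ?_ (ih (by omega)))
    · rcases hq : Φ.quant ⟨i, hi⟩ with _ | _
      · exact (adj_wit_all_iff hq).mpr (.inl rfl)
      · exact (adj_wit_ex_iff hq).mpr (.inl rfl)
    · rw [outFrom_of_lt hi]
      exact wit_reaches_out _

theorem out_reaches (i : Fin Φ.numVars) :
    Relation.ReflTransGen Φ.gltGraph.Adj (.out i) (Φ.outFrom 0) := by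
  have := outFrom_reaches (Φ := Φ) i.val i.2.le
  rwa [outFrom_of_lt i.2] at this

theorem wit_reaches (i : Fin Φ.numVars) :
    Relation.ReflTransGen Φ.gltGraph.Adj (.wit i) (Φ.outFrom 0) :=
  .head (wit_reaches_out i) (out_reaches i)

theorem lit_reaches (i : Fin Φ.numVars) (b : Bool) :
    Relation.ReflTransGen Φ.gltGraph.Adj (.lit i b) (Φ.outFrom 0) := by
  rcases hq : Φ.quant i with _ | _ <;> rcases b with _ | _
  · exact .head ((adj_out_all_iff hq).mpr (by simp)) (out_reaches i)
  · exact .head ((adj_wit_all_iff hq).mpr (by simp)) (wit_reaches i)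
  · exact .head ((adj_wit_ex_iff hq).mpr (by simp)) (wit_reaches i)
  · exact .head ((adj_wit_ex_iff hq).mpr (by simp)) (wit_reaches i)

theorem chk_reaches (d : ℕ) : ∀ j (_ : j + d = Φ.numClauses),
    Relation.ReflTransGen Φ.gltGraph.Adj (.chk ⟨j, by omega⟩) (Φ.outFrom 0) := by
  induction d with
  | zero =>
    intro j hj
    have := outFrom_reaches (Φ := Φ) _ le_rfl
    rw [outFrom_of_le le_rfl] at this
    convert this using 3
    exact hj
  | succ d ih =>
    intro j hj
    exact .head (adj_chk_iff (c := ⟨j, by omega⟩).mpr (.inl rfl)) (ih (j + 1) (by omega))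

/-- This gives the uniqueness of the root, and it also shows that a strategy for the output places a
pebble on every vertex along the way. -/
theorem reaches_outFrom_zero (v : Φ.Vertex) :
    Relation.ReflTransGen Φ.gltGraph.Adj v (Φ.outFrom 0) := by
  have hbar : ∀ i hi, Relation.ReflTransGen Φ.gltGraph.Adj (.bar i hi) (Φ.outFrom 0) :=
    fun i hi => .head ((adj_out_ex_iff hi).mpr (by simp)) (out_reaches i)
  rcases v with ⟨i, r, v⟩ | ⟨i, b⟩ | ⟨i, hi⟩ | i | i | j | ⟨j, k⟩
  · refine (apex_reaches _ _ v.1.1.2 v.1.2.2 v.2).trans ?_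
    fin_cases r
    · rcases hq : Φ.quant i with _ | _
      · exact .head ((adj_wit_all_iff hq).mpr (by simp)) (wit_reaches i)
      · exact .head (adj_lit_iff.mpr (belowLit_ex_true hq).symm) (lit_reaches i true)
    · rcases hq : Φ.quant i with _ | _
      · exact .head ((adj_wit_all_iff hq).mpr (by simp)) (wit_reaches i)
      · exact .head ((adj_wit_ex_iff hq).mpr (by simp)) (wit_reaches i)
    · rcases hq : Φ.quant i with _ | _
      · exact .head ((adj_out_all_iff hq).mpr (by simp)) (out_reaches i)
      · exact .head (adj_bar_iff.mpr (by simp)) (hbar i hq)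
  · exact lit_reaches i b
  · exact hbar i hi
  · exact wit_reaches i
  · exact out_reaches i
  · exact chk_reaches (Φ.numClauses - j) j (by omega)
  · exact .head (adj_chk_iff.mpr (.inr (.inr ⟨k, rfl⟩)))
      (chk_reaches (Φ.numClauses - (j + 1)) (j + 1) (by omega))

end QCNF

section AttachDiamond

variable {V : Type*} {G : Digraph V} {q : V} {k : ℕ}

/-- The vertex with the given coordinates in the diamond on top of `q`. The value outside the
diamond does not matter. -/
def diamondVertex (q : V) (k a b : ℕ) : V ⊕ DiamondInner k :=
  if h : (a < k ∧ b < k) ∧ ¬ (a = 0 ∧ b = 0) then .inr ⟨(⟨a, h.1.1⟩, ⟨b, h.1.2⟩), h.2⟩ else .inl q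

theorem diamondVertex_zero : diamondVertex q k 0 0 = .inl q := by
  simp [diamondVertex]

theorem diamondVertex_of_pos {a b : ℕ} (ha : a < k) (hb : b < k) (h : ¬ (a = 0 ∧ b = 0)) :
    diamondVertex q k a b = .inr ⟨(⟨a, ha⟩, ⟨b, hb⟩), h⟩ :=
  dif_pos ⟨⟨ha, hb⟩, h⟩

theorem exists_eq_diamondVertex (v : DiamondInner k) :
    ∃ a b, a < k ∧ b < k ∧ ¬ (a = 0 ∧ b = 0) ∧ (.inr v : V ⊕ DiamondInner k) =
      diamondVertex q k a b :=
  ⟨v.1.1, v.1.2, v.1.1.2, v.1.2.2, v.2, (diamondVertex_of_pos v.1.1.2 v.1.2.2 v.2).symm⟩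

theorem diamondVertex_injective {a b a' b' : ℕ} (ha : a < k) (hb : b < k) (ha' : a' < k)
    (hb' : b' < k) (h : diamondVertex q k a b = diamondVertex q k a' b') : a = a' ∧ b = b' := by
  unfold diamondVertex at h
  split_ifs at h with h1 h2
  · simpa using h
  · omega

/-- The edges into the diamond. -/
theorem attachDiamond_adj_iff {a b : ℕ} (ha : a < k) (hb : b < k) (h : ¬ (a = 0 ∧ b = 0))
    {u : V ⊕ DiamondInner k} :
    (attachDiamond G q k).Adj u (diamondVertex q k a b) ↔
      (∃ a', a = a' + 1 ∧ u = diamondVertex q k a' b) ∨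
      (∃ b', b = b' + 1 ∧ u = diamondVertex q k a b') := by
  rw [diamondVertex_of_pos ha hb h]
  rcases u with u | ⟨⟨⟨x, hx⟩, ⟨y, hy⟩⟩, hu⟩
  · simp only [attachDiamond, diamond, diamondVertex]
    constructor
    · rintro ⟨rfl, ⟨⟨x, hx⟩, ⟨y, hy⟩⟩, hx0, hy0, ⟨h1, h2⟩ | ⟨h1, h2⟩⟩
      · simp only [Fin.mk.injEq] at *
        exact .inl ⟨0, by omega, by rw [dif_neg (by omega)]⟩
      · simp only [Fin.mk.injEq] at *
        exact .inr ⟨0, by omega, by rw [dif_neg (by omega)]⟩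
    · rintro (⟨a', h1, h2⟩ | ⟨a', h1, h2⟩) <;> split_ifs at h2 with h3 <;>
        simp only [Sum.inl.injEq] at h2
      · exact ⟨h2, (⟨0, by omega⟩, ⟨0, by omega⟩), rfl, rfl,
          .inl ⟨by simp only; omega, by rw [Fin.ext_iff]; simp only; omega⟩⟩
      · exact ⟨h2, (⟨0, by omega⟩, ⟨0, by omega⟩), rfl, rfl,
          .inr ⟨by rw [Fin.ext_iff]; simp only; omega, by simp only; omega⟩⟩
  · simp only [attachDiamond, diamond, diamondVertex]
    simp only at hu
    constructor
    · rintro (⟨h1, h2⟩ | ⟨h1, h2⟩)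
      · simp only [Fin.mk.injEq] at *
        exact .inl ⟨x, by omega, by rw [dif_pos (by omega)]; simp only [h2]⟩
      · simp only [Fin.mk.injEq] at *
        exact .inr ⟨y, by omega, by rw [dif_pos (by omega)]; simp only [h1]⟩
    · rintro (⟨a', h1, h2⟩ | ⟨a', h1, h2⟩) <;> split_ifs at h2 with h3 <;>
        simp only [Sum.inr.injEq, Subtype.mk.injEq, Prod.mk.injEq, Fin.mk.injEq] at h2 ⊢ <;> omega

theorem diamond_reaches {a b : ℕ} (ha : a < k) (hb : b < k) :
    Relation.ReflTransGen (attachDiamond G q k).Adj (diamondVertex q k a b)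
      (diamondVertex q k (k - 1) (k - 1)) := by
  have h1 : ∀ d a, a + d = k - 1 → Relation.ReflTransGen (attachDiamond G q k).Adj
      (diamondVertex q k a b) (diamondVertex q k (k - 1) b) := by
    intro d
    induction d with
    | zero => rintro a rfl; exact .refl
    | succ d ih =>
      intro a h
      exact .head ((attachDiamond_adj_iff (by omega) hb (by omega)).mpr (.inl ⟨a, rfl, rfl⟩))
        (ih (a + 1) (by omega))
  have h2 : ∀ d b, b + d = k - 1 → Relation.ReflTransGen (attachDiamond G q k).Adj
      (diamondVertex q k (k - 1) b) (diamondVertex q k (k - 1) (k - 1)) := by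
    intro d
    induction d with
    | zero => rintro a rfl; exact .refl
    | succ d ih =>
      intro b h
      exact .head ((attachDiamond_adj_iff (by omega) (by omega) (by omega)).mpr
        (.inr ⟨b, rfl, rfl⟩)) (ih (b + 1) (by omega))
  exact (h1 (k - 1 - a) a (by omega)).trans (h2 (k - 1 - b) b (by omega))

theorem attachDiamond_reaches (hk : 0 < k) (hG : ∀ v, Relation.ReflTransGen G.Adj v q)
    (v : V ⊕ DiamondInner k) : Relation.ReflTransGen (attachDiamond G q k).Adj v
      (diamondVertex q k (k - 1) (k - 1)) := by
  rcases v with v | v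
  · have : Relation.ReflTransGen (attachDiamond G q k).Adj (.inl v) (.inl q) :=
      Relation.ReflTransGen.lift Sum.inl (fun _ _ h => h) _ _ (hG v)
    refine this.trans ?_
    rw [← diamondVertex_zero]
    exact diamond_reaches hk hk
  · obtain ⟨a, b, ha, hb, -, h⟩ := exists_eq_diamondVertex (q := q) v
    rw [h]
    exact diamond_reaches ha hb

/-- Every vertex reaches the corner, so no other vertex is a root; no edge leaves the corner, since
it would have to increase a coordinate. -/
theorem attachDiamond_isRoot_iff (hk : 2 ≤ k) (hG : ∀ v, Relation.ReflTransGen G.Adj v q)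
    (v : V ⊕ DiamondInner k) :
    (attachDiamond G q k).IsRoot v ↔ v = diamondVertex q k (k - 1) (k - 1) := by
  constructor
  · intro h
    rcases Relation.ReflTransGen.cases_head (attachDiamond_reaches (by omega) hG v) with h' | h'
    · exact h'
    · obtain ⟨w, hw, -⟩ := h'
      exact absurd hw (h w)
  · rintro rfl w hw
    have hd : diamondVertex q k (k - 1) (k - 1) = _ :=
      diamondVertex_of_pos (by omega) (by omega) (by omega)
    rcases w with w | w
    · rw [hd] at hw
      exact hw
    · obtain ⟨a, b, ha, hb, h0, h⟩ := exists_eq_diamondVertex (q := q) w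
      rw [h, attachDiamond_adj_iff ha hb h0] at hw
      rcases hw with ⟨a', h1, h2⟩ | ⟨a', h1, h2⟩
      · have := diamondVertex_injective (by omega) (by omega) (by omega) (by omega) h2
        omega
      · have := diamondVertex_injective (by omega) (by omega) (by omega) (by omega) h2
        omega

end AttachDiamond

/-! ### The number of vertices -/

namespace QCNF

variable (Φ : QCNF)

/-- An explicit type that contains the vertices. -/
abbrev VertexCode : Type :=
  (Fin Φ.numVars × Fin 3 × Fin (3 * Φ.numVars + 3) × Fin (3 * Φ.numVars + 3)) ⊕
  (Fin Φ.numVars × Fin 5) ⊕ Fin (Φ.numClauses + 1) ⊕ (Fin Φ.numClauses × Fin 3)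

theorem pyramidSize_le (i : Fin Φ.numVars) (r : Fin 3) :
    Φ.pyramidSize i r ≤ 3 * Φ.numVars + 3 := by
  unfold pyramidSize
  omega

/-- The injection of the vertices into `VertexCode`. -/
def vertexCode : Φ.Vertex → Φ.VertexCode
  | .pyr i r v => .inl (i, r, v.1.1.castLE (Φ.pyramidSize_le i r),
      v.1.2.castLE (Φ.pyramidSize_le i r))
  | .lit i b => .inr (.inl (i, if b then 0 else 1))
  | .bar i _ => .inr (.inl (i, 2))
  | .wit i => .inr (.inl (i, 3))
  | .out i => .inr (.inl (i, 4))
  | .chk j => .inr (.inr (.inl j))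
  | .pad j k => .inr (.inr (.inr (j, k.castLE (by omega))))

theorem vertexCode_injective : Function.Injective Φ.vertexCode := by
  rintro (⟨i, r, v⟩ | ⟨i, b⟩ | ⟨i, hi⟩ | i | i | j | ⟨j, k⟩)
    (⟨i', r', v'⟩ | ⟨i', b'⟩ | ⟨i', hi'⟩ | i' | i' | j' | ⟨j', k'⟩) h <;>
    simp only [vertexCode, reduceCtorEq, Sum.inl.injEq, Sum.inr.injEq, Prod.mk.injEq] at h
  · obtain ⟨rfl, rfl, h1, h2⟩ := h
    congr 1
    exact Subtype.ext (Prod.ext (Fin.castLE_injective _ h1) (Fin.castLE_injective _ h2))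
  all_goals first
    | (obtain ⟨rfl, h⟩ := h; cases b <;> cases b' <;> simp at h <;> rfl)
    | (obtain ⟨rfl, h⟩ := h; cases b <;> simp at h)
    | (obtain ⟨rfl, h⟩ := h; cases b' <;> simp at h)
    | (obtain ⟨rfl, h⟩ := h; obtain rfl := Fin.castLE_injective _ h; rfl)
    | (obtain ⟨rfl, h⟩ := h; first | rfl | simp at h)

instance : Finite Φ.Vertex := .of_injective _ Φ.vertexCode_injective

theorem card_vertex_le : Nat.card Φ.Vertex ≤
    Φ.numVars * (3 * ((3 * Φ.numVars + 3) * (3 * Φ.numVars + 3))) + (Φ.numVars * 5 +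
      (Φ.numClauses + 1 + Φ.numClauses * 3)) := by
  refine (Nat.card_le_card_of_injective _ Φ.vertexCode_injective).trans ?_
  simp [VertexCode]

/-- Pyramids contribute at most 27 times the cube, the diamond 16 times the square, and all other
vertices 5 times the first power; 100 is generous. -/
theorem card_spookyVertex_le : Nat.card Φ.SpookyVertex ≤ 100 * Φ.size ^ 3 := by
  have h1 := Φ.card_vertex_le
  have h2 : Nat.card (DiamondInner (3 * Φ.numVars + 4)) ≤
      (3 * Φ.numVars + 4) * (3 * Φ.numVars + 4) := by
    refine (Nat.card_le_card_of_injective _ Subtype.val_injective).trans ?_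
    simp
  have h3 : Nat.card Φ.SpookyVertex = _ := Nat.card_sum
  rw [h3]
  unfold size
  generalize Φ.numVars = n at *
  generalize Φ.numClauses = m at *
  have e1 : n * (3 * ((3 * n + 3) * (3 * n + 3))) ≤ 27 * (n + m + 1) ^ 3 := by
    calc n * (3 * ((3 * n + 3) * (3 * n + 3))) = 27 * (n * ((n + 1) * (n + 1))) := by ring
      _ ≤ 27 * ((n + m + 1) * ((n + m + 1) * (n + m + 1))) := by gcongr <;> omega
      _ = 27 * (n + m + 1) ^ 3 := by ring
  have e2 : (3 * n + 4) * (3 * n + 4) ≤ 16 * (n + m + 1) ^ 2 := by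
    calc (3 * n + 4) * (3 * n + 4) ≤ (4 * (n + m + 1)) * (4 * (n + m + 1)) := by gcongr <;> omega
      _ = 16 * (n + m + 1) ^ 2 := by ring
  have e3 : (n + m + 1) ^ 2 ≤ (n + m + 1) ^ 3 := Nat.pow_le_pow_right (by omega) (by omega)
  have e4 : (n + m + 1) ^ 1 ≤ (n + m + 1) ^ 3 := Nat.pow_le_pow_right (by omega) (by omega)
  rw [pow_one] at e4
  omega

end QCNF

/-! ### Pebbling the graph needs a true formula -/

namespace QCNF

variable {Φ : QCNF}

/-- The block to which a vertex belongs; the clauses form the last block. -/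
def blk : Φ.Vertex → ℕ
  | .pyr i _ _ => i
  | .lit i _ => i
  | .bar i _ => i
  | .wit i => i
  | .out i => i
  | .chk _ => Φ.numVars
  | .pad _ _ => Φ.numVars

/-- The part of its block to which a vertex belongs: `0, 1, 2` are the pyramids, `3` and `4` the
positive and the negative literal, `5` the vertex below the negative literal of an existential
variable, `6` the witness vertex, `7` the output of the block. -/
def part : Φ.Vertex → ℕ
  | .pyr _ r _ => r
  | .lit _ b => if b then 3 else 4
  | .bar _ _ => 5
  | .wit _ => 6
  | .out _ => 7
  | .chk _ => 8
  | .pad _ _ => 9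

/-- The number of pebbles on a part of a block. -/
def cnt (P : Finset Φ.Vertex) (i l : ℕ) : ℕ := (P.filter (fun v => blk v = i ∧ part v = l)).card

/-- The number of pebbles on a block. -/
def blkCard (P : Finset Φ.Vertex) (i : ℕ) : ℕ := (P.filter (fun v => blk v = i)).card

/-- The number of pebbles on the blocks from `i` on. -/
def rest (P : Finset Φ.Vertex) (i : ℕ) : ℕ := (P.filter (fun v => i ≤ blk v)).card

theorem cnt_pos {P : Finset Φ.Vertex} {v : Φ.Vertex} {i l : ℕ} (hv : v ∈ P) (h1 : blk v = i)
    (h2 : part v = l) : 1 ≤ cnt P i l :=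
  Finset.card_pos.mpr ⟨v, Finset.mem_filter.mpr ⟨hv, h1, h2⟩⟩

theorem notMem_of_cnt {P : Finset Φ.Vertex} {v : Φ.Vertex} {i l : ℕ} (h : cnt P i l = 0)
    (h1 : blk v = i) (h2 : part v = l) : v ∉ P := fun hv => by
  have := cnt_pos hv h1 h2
  omega

theorem blkCard_eq (P : Finset Φ.Vertex) {i : ℕ} (hi : i < Φ.numVars) :
    blkCard P i = cnt P i 0 + cnt P i 1 + cnt P i 2 + cnt P i 3 + cnt P i 4 + cnt P i 5 +
      cnt P i 6 + cnt P i 7 := by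
  have h : ∀ v ∈ P.filter (fun v => blk v = i), part v ∈ Finset.range 8 := by
    intro v hv
    have hv := (Finset.mem_filter.mp hv).2
    rw [Finset.mem_range]
    rcases v with ⟨j, r, v⟩ | ⟨j, b⟩ | ⟨j, hj⟩ | j | j | j | ⟨j, k⟩ <;> simp only [blk, part] at * <;>
      first | omega | (split_ifs <;> omega)
  rw [blkCard, Finset.card_eq_sum_card_fiberwise h]
  simp only [Finset.filter_filter, Finset.sum_range_succ, Finset.sum_range_zero, zero_add]
  rfl

theorem rest_eq (P : Finset Φ.Vertex) (i : ℕ) : rest P i = blkCard P i + rest P (i + 1) := by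
  unfold rest blkCard
  rw [← Finset.card_union_of_disjoint]
  · congr 1
    ext v
    simp only [Finset.mem_filter, Finset.mem_union]
    rw [← and_or_left]
    exact and_congr_right fun _ => by omega
  · rw [Finset.disjoint_filter]
    intros
    omega

/-- Lower bounds for the blocks before `i` bound the number of pebbles on the other blocks. -/
theorem sum_add_rest_le {P : Finset Φ.Vertex} (f : ℕ → ℕ) (i : ℕ)
    (h : ∀ j < i, f j ≤ blkCard P j) : (∑ j ∈ Finset.range i, f j) + rest P i ≤ P.card := by
  induction i with
  | zero => simp [rest]
  | succ i ih =>
    have h1 := ih fun j hj => h j (by omega)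
    have h2 := h i (by omega)
    rw [rest_eq] at h1
    rw [Finset.sum_range_succ]
    omega

theorem blk_lt_of_rest {P : Finset Φ.Vertex} {i : ℕ} (h : rest P i = 0) : ∀ v ∈ P, blk v < i := by
  intro v hv
  by_contra hc
  have : 0 < rest P i := Finset.card_pos.mpr ⟨v, Finset.mem_filter.mpr ⟨hv, by omega⟩⟩
  omega

/-! The pyramids -/

/-- The vertices of a pyramid as a triangular grid. The value outside the pyramid does not
matter. -/
def pyrGrid (i : Fin Φ.numVars) (r : Fin 3) (a b : ℕ) : Φ.Vertex :=
  if h : a + b < Φ.pyramidSize i r then .pyr i r ⟨(⟨a, by omega⟩, ⟨b, by omega⟩), h⟩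
  else Φ.apex i r

theorem pyrGrid_zero (i : Fin Φ.numVars) (r : Fin 3) : pyrGrid i r 0 0 = Φ.apex i r := by
  unfold pyrGrid
  split_ifs <;> rfl

theorem pyrGrid_inj {i : Fin Φ.numVars} {r : Fin 3} {a b a' b' : ℕ}
    (h : a + b < Φ.pyramidSize i r) (h' : a' + b' < Φ.pyramidSize i r)
    (he : pyrGrid i r a b = pyrGrid i r a' b') : a = a' ∧ b = b' := by
  rw [pyrGrid, dif_pos h, pyrGrid, dif_pos h'] at he
  simpa using he

theorem blk_pyrGrid (i : Fin Φ.numVars) (r : Fin 3) (a b : ℕ) : blk (pyrGrid i r a b) = i := by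
  unfold pyrGrid
  split_ifs <;> rfl

theorem part_pyrGrid (i : Fin Φ.numVars) (r : Fin 3) (a b : ℕ) : part (pyrGrid i r a b) = r := by
  unfold pyrGrid
  split_ifs <;> rfl

theorem pyrGrid_adj_left {i : Fin Φ.numVars} {r : Fin 3} {a b : ℕ}
    (h : a + b + 1 < Φ.pyramidSize i r) :
    Φ.gltGraph.Adj (pyrGrid i r (a + 1) b) (pyrGrid i r a b) := by
  rw [pyrGrid, dif_pos (by omega), pyrGrid, dif_pos (by omega)]
  exact adj_pyr_iff.mpr ⟨⟨(⟨a + 1, by omega⟩, ⟨b, by omega⟩), by simp only; omega⟩,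
    .inl ⟨rfl, rfl⟩, rfl⟩

theorem pyrGrid_adj_right {i : Fin Φ.numVars} {r : Fin 3} {a b : ℕ}
    (h : a + b + 1 < Φ.pyramidSize i r) :
    Φ.gltGraph.Adj (pyrGrid i r a (b + 1)) (pyrGrid i r a b) := by
  rw [pyrGrid, dif_pos (by omega), pyrGrid, dif_pos (by omega)]
  exact adj_pyr_iff.mpr ⟨⟨(⟨a, by omega⟩, ⟨b + 1, by omega⟩), by simp only; omega⟩,
    .inr ⟨rfl, rfl⟩, rfl⟩

theorem four_le_pyramidSize (i : Fin Φ.numVars) (r : Fin 3) : 4 ≤ Φ.pyramidSize i r := by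
  unfold pyramidSize
  omega

/-- The bottom row of the pyramid is left out on purpose. When a vertex of the row above it is
placed, its two predecessors in the bottom row are pebbled; they add two to the count for the
smaller grid, which gives the size of the pyramid plus one. -/
theorem isGrid_pyrGrid (i : Fin Φ.numVars) (r : Fin 3) :
    IsGrid Φ.gltGraph (pyrGrid i r) (Φ.pyramidSize i r - 1) where
  inj _ _ _ _ h h' he := pyrGrid_inj (by omega) (by omega) he
  adj_left _ _ _ := pyrGrid_adj_left (by omega)
  adj_right _ _ _ := pyrGrid_adj_right (by omega)

/-- Some path from the last row but one of a pyramid to the row below the apex is free of pebbles,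
and so is `F`. -/
def PyrOpen (i : Fin Φ.numVars) (r : Fin 3) (F : Set Φ.Vertex) (P : Finset Φ.Vertex) : Prop :=
  GridOpen (pyrGrid i r) (Φ.pyramidSize i r - 1) F P

variable {P : ℕ → Finset Φ.Vertex} {i : Fin Φ.numVars} {r : Fin 3} {F : Set Φ.Vertex}

theorem pyrOpen_of_cnt {Q : Finset Φ.Vertex} (h : cnt Q i r = 0) (hF : ∀ x ∈ F, x ∉ Q) :
    PyrOpen i r F Q :=
  .of_forall_notMem (fun _ _ _ _ => notMem_of_cnt h (blk_pyrGrid _ _ _ _) (part_pyrGrid _ _ _ _)) hF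

theorem not_pyrOpen_of_mem {Q : Finset Φ.Vertex} {x : Φ.Vertex} (hx : x ∈ F) (h : x ∈ Q) :
    ¬ PyrOpen i r F Q := fun ho => ho.2 x hx h

theorem exists_mem_of_not_pyrOpen {Q : Finset Φ.Vertex} (h : ¬ PyrOpen i r F Q) :
    1 ≤ cnt Q i r ∨ ∃ x ∈ F, x ∈ Q := by
  obtain ⟨x, hx, h | h⟩ := exists_mem_of_not_gridOpen h
  · obtain ⟨a, b, -, -, rfl⟩ := mem_gridCells.mp h
    exact .inl (cnt_pos hx (blk_pyrGrid _ _ _ _) (part_pyrGrid _ _ _ _))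
  · exact .inr ⟨x, h, hx⟩

/-- When a pyramid is closed for the last time, it carries one pebble more than it has sources. -/
theorem exists_last_pyramid_fill (hP : ∀ t, BlackMove Φ.gltGraph (P t) (P (t + 1)))
    (hF : ∀ v ∈ F, v = Φ.apex i r ∨ ∃ u ∈ F, Φ.gltGraph.Adj u v) {t₀ t₁ : ℕ} (h : t₀ ≤ t₁)
    (ho : PyrOpen i r F (P t₀)) (hc : ¬ PyrOpen i r F (P t₁)) :
    ∃ τ, t₀ ≤ τ ∧ τ < t₁ ∧ PyrOpen i r F (P τ) ∧ (∀ t, τ < t → t ≤ t₁ → ¬ PyrOpen i r F (P t)) ∧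
      (∀ x ∈ F, x ∉ P (τ + 1)) ∧ P τ ⊆ P (τ + 1) ∧
      Φ.pyramidSize i r + 1 ≤ cnt (P (τ + 1)) i r := by
  have hs := four_le_pyramidSize i r
  obtain ⟨τ, h1, h2, h3, h4, h5, ⟨a, ha, ha', hpred⟩, h6⟩ :=
    (isGrid_pyrGrid i r).exists_last_fill (F := F) (fun v hv => by
      rcases hF v hv with rfl | h
      · rw [← pyrGrid_zero]
        exact .inr ⟨pyrGrid_adj_right (by omega), pyrGrid_adj_left (by omega)⟩
      · exact .inl h) (by omega) hP h ho hc
  refine ⟨τ, h1, h2, h3, h4, h5, by rw [ha']; exact Finset.subset_insert _ _, ?_⟩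
  set s := Φ.pyramidSize i r with hsdef
  set b := s - 1 - 1 - a with hb
  have e1 : pyrGrid i r (a + 1) b ∈ P (τ + 1) := by
    rw [ha']; exact Finset.mem_insert_of_mem (hpred _ (pyrGrid_adj_left (by omega)))
  have e2 : pyrGrid i r a (b + 1) ∈ P (τ + 1) := by
    rw [ha']; exact Finset.mem_insert_of_mem (hpred _ (pyrGrid_adj_right (by omega)))
  have e3 : pyrGrid i r a (b + 1) ∉ P (τ + 1) ∩ gridCells (pyrGrid i r) (s - 1) := by
    intro hm
    obtain ⟨x, y, -, hxy, he⟩ := mem_gridCells.mp (Finset.mem_inter.mp hm).2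
    have := pyrGrid_inj (by omega) (by omega) he
    omega
  have e4 : pyrGrid i r (a + 1) b ∉
      insert (pyrGrid i r a (b + 1)) (P (τ + 1) ∩ gridCells (pyrGrid i r) (s - 1)) := by
    intro hm
    rcases Finset.mem_insert.mp hm with he | hm
    · have := pyrGrid_inj (by omega) (by omega) he
      omega
    · obtain ⟨x, y, -, hxy, he⟩ := mem_gridCells.mp (Finset.mem_inter.mp hm).2
      have := pyrGrid_inj (by omega) (by omega) he
      omega
  have e5 := Finset.card_insert_of_notMem e4
  rw [Finset.card_insert_of_notMem e3] at e5
  calc s + 1 ≤ (insert (pyrGrid i r (a + 1) b) (insert (pyrGrid i r a (b + 1))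
        (P (τ + 1) ∩ gridCells (pyrGrid i r) (s - 1)))).card := by omega
    _ ≤ _ := by
      refine Finset.card_le_card ?_
      intro x hx
      rw [Finset.mem_filter]
      rcases Finset.mem_insert.mp hx with rfl | hx
      · exact ⟨e1, blk_pyrGrid _ _ _ _, part_pyrGrid _ _ _ _⟩
      rcases Finset.mem_insert.mp hx with rfl | hx
      · exact ⟨e2, blk_pyrGrid _ _ _ _, part_pyrGrid _ _ _ _⟩
      obtain ⟨h7, h8⟩ := Finset.mem_inter.mp hx
      obtain ⟨x, y, -, hxy, rfl⟩ := mem_gridCells.mp h8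
      exact ⟨h7, blk_pyrGrid _ _ _ _, part_pyrGrid _ _ _ _⟩

/-- Pebbling the apex of an empty pyramid takes one pebble more than it has sources. -/
theorem exists_pyramid_fill (hP : ∀ t, BlackMove Φ.gltGraph (P t) (P (t + 1))) {t₀ t₁ : ℕ}
    (h : t₀ ≤ t₁) (h₀ : cnt (P t₀) i r = 0) (h₁ : Φ.apex i r ∈ P t₁) :
    ∃ τ, t₀ ≤ τ ∧ τ < t₁ ∧ PyrOpen i r {Φ.apex i r} (P τ) ∧ P τ ⊆ P (τ + 1) ∧
      Φ.pyramidSize i r + 1 ≤ cnt (P (τ + 1)) i r := by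
  obtain ⟨τ, h1, h2, h3, -, -, h5, h6⟩ := exists_last_pyramid_fill (i := i) (r := r)
    (F := {Φ.apex i r}) hP (fun v hv => .inl hv) h
    (pyrOpen_of_cnt h₀ fun x hx => by
      rw [Set.mem_singleton_iff.mp hx]; exact notMem_of_cnt h₀ rfl rfl)
    (not_pyrOpen_of_mem rfl h₁)
  exact ⟨τ, h1, h2, h3, h5, h6⟩

/-! ### What pebbling a single block forces -/

/-- A part of the interval `[t₀, t₁]` in which the rest of the graph is pebbled from scratch while
the block of `xᵢ` keeps three pebbles, and a fourth one if the literal of `xᵢ` that is false for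
the value `b` is pebbled. -/
def HasPhase (P : ℕ → Finset Φ.Vertex) (i : Fin Φ.numVars) (b : Bool) (t₀ t₁ : ℕ) : Prop :=
  ∃ u₀ u₁, t₀ ≤ u₀ ∧ u₀ ≤ u₁ ∧ u₁ ≤ t₁ ∧ (∀ v ∈ P u₀, blk v < i.val + 1) ∧
    Φ.outFrom (i.val + 1) ∈ P u₁ ∧ ∀ t, u₀ ≤ t → t ≤ u₁ →
      3 + (if Vertex.lit i (!b) ∈ P t then 1 else 0) ≤ blkCard (P t) i

theorem pyramidSize_zero (i : Fin Φ.numVars) : Φ.pyramidSize i 0 = 3 * (Φ.numVars - i) + 3 := rfl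
theorem pyramidSize_one (i : Fin Φ.numVars) : Φ.pyramidSize i 1 = 3 * (Φ.numVars - i) + 2 := rfl
theorem pyramidSize_two (i : Fin Φ.numVars) : Φ.pyramidSize i 2 = 3 * (Φ.numVars - i) + 1 := rfl

/-- Each of the three fills exhausts the budget, so they happen in order, and the rest is empty
after the last one. Until the witness is placed, three pebbles remain: one on the first pyramid or
the positive literal, one on the second pyramid, one on the third pyramid or the vertices leading to
the negative literal. Having both literals pebbled with only three pebbles would give up the first
and the third pyramid as well as `bar`, which is still needed for the output of the block and too
expensive to recover. -/
theorem hasPhase_ex (hq : Φ.quant i = .ex) (hP : ∀ t, BlackMove Φ.gltGraph (P t) (P (t + 1)))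
    {t₀ t₁ : ℕ} (h : t₀ ≤ t₁) (h₀ : ∀ v ∈ P t₀, blk v < i.val) (h₁ : .out i ∈ P t₁)
    (hbud : ∀ t, t₀ ≤ t → t ≤ t₁ →
      blkCard (P t) i + rest (P t) (i + 1) ≤ 3 * (Φ.numVars - i) + 4) :
    ∃ b, HasPhase P i b t₀ t₁ := by
  have hs0 := pyramidSize_zero i
  have hs1 := pyramidSize_one i
  have hs2 := pyramidSize_two i
  have hn0 : ∀ l, cnt (P t₀) i l = 0 := by
    intro l
    rw [cnt, Finset.card_eq_zero, Finset.filter_eq_empty_iff]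
    intro v hv
    have := h₀ v hv
    omega
  have hpos : ∀ {t : ℕ} {v : Φ.Vertex} {l : ℕ}, v ∈ P t → blk v = i → part v = l →
      1 ≤ cnt (P t) i l := fun hv h h' => cnt_pos hv h h'
  simp only [blkCard_eq _ i.2] at hbud
  -- the last placements of the output and of the witness
  obtain ⟨t₂, h1, h2, hpre, -⟩ :=
    exists_last_placement hP h (notMem_of_cnt (hn0 7) (v := .out i) rfl rfl) h₁
  have hwit := hpre _ ((adj_out_ex_iff hq).mpr (.inl rfl))
  have hbar := hpre _ ((adj_out_ex_iff hq).mpr (.inr rfl))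
  obtain ⟨tg, h3, h4, hpre', hstay⟩ :=
    exists_last_placement hP h1 (notMem_of_cnt (hn0 6) (v := .wit i) rfl rfl) hwit
  have hout := hpre' _ ((adj_wit_ex_iff hq).mpr (.inl rfl))
  have hd := hpre' _ ((adj_wit_ex_iff hq).mpr (.inr (.inl rfl)))
  have hx := hpre' _ ((adj_wit_ex_iff hq).mpr (.inr (.inr (.inl rfl))))
  have hx' := hpre' _ ((adj_wit_ex_iff hq).mpr (.inr (.inr (.inr rfl))))
  -- the three pyramids are filled in this order
  obtain ⟨τa, a1, a2, -, a3, -, -, a4⟩ := exists_last_pyramid_fill (i := i) (r := 0)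
    -- Including the literal in `F` covers the case that the pebble of this pyramid has moved up to
    -- the literal. The set for the third pyramid is chosen likewise.
    (F := {Φ.apex i 0, .lit i true}) hP (by
      rintro v (rfl | rfl)
      · exact .inl rfl
      · exact .inr ⟨Φ.apex i 0, by simp, adj_lit_iff.mpr (belowLit_ex_true hq).symm⟩) h3
    (pyrOpen_of_cnt (hn0 0) (by
      rintro v (rfl | rfl)
      · exact notMem_of_cnt (hn0 0) rfl rfl
      · exact notMem_of_cnt (hn0 3) rfl rfl))
    (not_pyrOpen_of_mem (x := .lit i true) (by simp) hx)
  have hA : ∀ t, τa < t → t ≤ tg → 1 ≤ cnt (P t) i 0 + cnt (P t) i 3 := by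
    intro t ht ht'
    rcases exists_mem_of_not_pyrOpen (a3 t ht ht') with h | ⟨x, rfl | rfl, hm⟩
    · exact Nat.le_add_right_of_le h
    · exact Nat.le_add_right_of_le (hpos hm rfl rfl)
    · exact Nat.le_add_left_of_le (hpos hm rfl rfl)
  have b0 := hbud (τa + 1) (by omega) (by omega)
  -- The filled pyramid carries `3(n - i) + 4` pebbles, which is the whole budget.
  have hz1 : cnt (P (τa + 1)) i 1 = 0 := by simp only [Fin.val_zero] at a4; omega
  obtain ⟨τd, d1, d2, -, d3, -, -, d4⟩ := exists_last_pyramid_fill (i := i) (r := 1)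
    (F := {Φ.apex i 1}) hP (fun v hv => .inl hv) (show τa + 1 ≤ tg by omega)
    (pyrOpen_of_cnt hz1 (by rintro v rfl; exact notMem_of_cnt hz1 rfl rfl))
    (not_pyrOpen_of_mem rfl hd)
  have hD : ∀ t, τd < t → t ≤ tg → 1 ≤ cnt (P t) i 1 := by
    intro t ht ht'
    rcases exists_mem_of_not_pyrOpen (d3 t ht ht') with h | ⟨x, rfl, hm⟩
    · exact h
    · exact hpos hm rfl rfl
  have b1 := hbud (τd + 1) (by omega) (by omega)
  have b1' := hA (τd + 1) (by omega) (by omega)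
  simp only [Fin.val_one] at d4
  have hz2 : cnt (P (τd + 1)) i 2 = 0 := by omega
  have hz4 : cnt (P (τd + 1)) i 4 = 0 := by omega
  have hz5 : cnt (P (τd + 1)) i 5 = 0 := by omega
  obtain ⟨τc, c1, c2, -, c3, -, -, c4⟩ := exists_last_pyramid_fill (i := i) (r := 2)
    (F := {Φ.apex i 2, .bar i hq, .lit i false}) hP (by
      rintro v (rfl | rfl | rfl)
      · exact .inl rfl
      · exact .inr ⟨Φ.apex i 2, by simp, adj_bar_iff.mpr (.inr rfl)⟩
      · exact .inr ⟨.bar i hq, by simp, adj_lit_iff.mpr (belowLit_ex_false hq).symm⟩)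
    (show τd + 1 ≤ tg by omega)
    (pyrOpen_of_cnt hz2 (by
      rintro v (rfl | rfl | rfl)
      · exact notMem_of_cnt hz2 rfl rfl
      · exact notMem_of_cnt hz5 rfl rfl
      · exact notMem_of_cnt hz4 rfl rfl))
    (not_pyrOpen_of_mem (x := .lit i false) (by simp) hx')
  have hC : ∀ t, τc < t → t ≤ tg → 1 ≤ cnt (P t) i 2 + cnt (P t) i 5 + cnt (P t) i 4 := by
    intro t ht ht'
    rcases exists_mem_of_not_pyrOpen (c3 t ht ht') with h | ⟨x, rfl | rfl | rfl, hm⟩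
    · simp only [Fin.val_two] at h
      omega
    · have := hpos (l := 2) hm rfl rfl
      omega
    · have := hpos (l := 5) hm rfl rfl
      omega
    · have := hpos (l := 4) hm rfl rfl
      omega
  have b2 := hbud (τc + 1) (by omega) (by omega)
  have b2' := hA (τc + 1) (by omega) (by omega)
  have b2'' := hD (τc + 1) (by omega) (by omega)
  simp only [Fin.val_two] at c4
  have hrest := blk_lt_of_rest (show rest (P (τc + 1)) (i + 1) = 0 by omega)
  -- The value is `false` unless the positive literal is at some time pebbled with no fourth pebble
  -- on the block. In that case the first pyramid is empty at this time and the value is `true`.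
  by_cases hcase : ∃ tx, τc + 1 ≤ tx ∧ tx ≤ tg ∧ .lit i true ∈ P tx ∧ blkCard (P tx) i ≤ 3
  · -- without the first pyramid the vertex below the negative literal must be kept
    obtain ⟨tx, e1, e2, e3, e4⟩ := hcase
    rw [blkCard_eq _ i.2] at e4
    have hbar'' : Vertex.bar i hq ∈ P tx := by
      by_contra hb
      obtain ⟨t₃, f1, f2, f3, -⟩ := exists_last_placement hP (by omega) hb hbar
      have g1 := hD tx (by omega) e2
      have g2 := hC tx (by omega) e2
      have g3 := hpos (l := 3) e3 rfl rfl
      obtain ⟨τ, k1, k2, -, -, k3⟩ := exists_pyramid_fill (i := i) (r := 0) hP f1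
        (show cnt (P tx) i 0 = 0 by omega) (f3 _ (adj_bar_iff.mpr (.inl rfl)))
      have k4 := hbud (τ + 1) (by omega) (by omega)
      simp only [Fin.val_zero] at k3
      rcases Nat.lt_or_ge tg (τ + 1) with h | h
      · have := hpos (l := 6) (hstay (τ + 1) h (by omega)) rfl rfl
        omega
      · have := hD (τ + 1) (by omega) h
        omega
    refine ⟨true, τc + 1, tg, by omega, by omega, by omega, hrest, hout, fun t ht ht' => ?_⟩
    have g1 := hA t (by omega) ht'
    have g2 := hD t (by omega) ht'
    have g3 := hC t (by omega) ht'
    rw [blkCard_eq _ i.2]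
    split_ifs with hl
    swap
    · omega
    by_contra hcon
    have g4 := hpos (l := 4) hl rfl rfl
    have hz2 : cnt (P t) i 2 = 0 := by omega
    have hz5 : cnt (P t) i 5 = 0 := by omega
    have hb : Vertex.bar i hq ∉ P t := notMem_of_cnt hz5 rfl rfl
    -- Without `bar` at time `t`, it has to be placed again. Before `tx` this refills the third
    -- pyramid, with the block otherwise so empty that the pyramid is open again after `τc`. After
    -- `tx` this refills the first pyramid, which leaves no pebble for the second pyramid or for the
    -- witness.
    rcases le_total t tx with hle | hle
    · obtain ⟨t₃, f1, f2, f3, -⟩ := exists_last_placement hP hle hb hbar''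
      obtain ⟨τ, k1, k2, k3, k4, k5⟩ := exists_pyramid_fill (i := i) (r := 2) hP f1
        hz2 (f3 _ (adj_bar_iff.mpr (.inr rfl)))
      have k6 := hbud (τ + 1) (by omega) (by omega)
      have k7 := hA (τ + 1) (by omega) (by omega)
      have k8 := hD (τ + 1) (by omega) (by omega)
      simp only [Fin.val_two] at k5
      refine c3 τ (by omega) (by omega) ⟨k3.1, ?_⟩
      rintro v (rfl | rfl | rfl)
      · exact k3.2 _ rfl
      · exact fun hm => notMem_of_cnt (show cnt (P (τ + 1)) i 5 = 0 by omega) rfl rfl (k4 hm)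
      · exact fun hm => notMem_of_cnt (show cnt (P (τ + 1)) i 4 = 0 by omega) rfl rfl (k4 hm)
    · obtain ⟨t₃, f1, f2, f3, -⟩ := exists_last_placement hP (show t ≤ t₂ by omega) hb hbar
      have g1 := hD tx (by omega) e2
      have g2 := hC tx (by omega) e2
      have g3 := hpos (l := 3) e3 rfl rfl
      obtain ⟨τ, k1, k2, -, -, k3⟩ := exists_pyramid_fill (i := i) (r := 0) hP
        (show tx ≤ t₃ by omega)
        (show cnt (P tx) i 0 = 0 by omega) (f3 _ (adj_bar_iff.mpr (.inl rfl)))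
      have k4 := hbud (τ + 1) (by omega) (by omega)
      simp only [Fin.val_zero] at k3
      rcases Nat.lt_or_ge tg (τ + 1) with h | h
      · have := hpos (l := 6) (hstay (τ + 1) h (by omega)) rfl rfl
        omega
      · have := hD (τ + 1) (by omega) h
        omega
  · refine ⟨false, τc + 1, tg, by omega, by omega, by omega, hrest, hout, fun t ht ht' => ?_⟩
    have g1 := hA t (by omega) ht'
    have g2 := hD t (by omega) ht'
    have g3 := hC t (by omega) ht'
    split_ifs with hl
    · by_contra hcon
      exact hcase ⟨t, ht, ht', hl, by omega⟩
    · rw [blkCard_eq _ i.2]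
      omega

/-- The value `true` is served by the phase before the witness, where the third pebble is on the
third pyramid or the positive literal. For `false`, either the third pyramid stays blocked
throughout that phase, so that neither literal counts among the three pebbles, or it is refilled
after the witness. The refill again uses up the budget, and the later blocks must be pebbled a
second time, since their output is also an input of `out`. -/
theorem hasPhase_all (hq : Φ.quant i = .all) (hP : ∀ t, BlackMove Φ.gltGraph (P t) (P (t + 1)))
    {t₀ t₁ : ℕ} (h : t₀ ≤ t₁) (h₀ : ∀ v ∈ P t₀, blk v < i.val) (h₁ : .out i ∈ P t₁)
    (hbud : ∀ t, t₀ ≤ t → t ≤ t₁ →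
      blkCard (P t) i + rest (P t) (i + 1) ≤ 3 * (Φ.numVars - i) + 4) (b : Bool) :
    HasPhase P i b t₀ t₁ := by
  have hs0 := pyramidSize_zero i
  have hs1 := pyramidSize_one i
  have hs2 := pyramidSize_two i
  have hn0 : ∀ l, cnt (P t₀) i l = 0 := by
    intro l
    rw [cnt, Finset.card_eq_zero, Finset.filter_eq_empty_iff]
    intro v hv
    have := h₀ v hv
    omega
  have hpos : ∀ {t : ℕ} {v : Φ.Vertex} {l : ℕ}, v ∈ P t → blk v = i → part v = l →
      1 ≤ cnt (P t) i l := fun hv h h' => cnt_pos hv h h'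
  simp only [blkCard_eq _ i.2] at hbud
  -- the last placements of the output and of the witness
  obtain ⟨t₂, h1, h2, hpre, -⟩ :=
    exists_last_placement hP h (notMem_of_cnt (hn0 7) (v := .out i) rfl rfl) h₁
  have hout₂ := hpre _ ((adj_out_all_iff hq).mpr (.inl rfl))
  have hwit := hpre _ ((adj_out_all_iff hq).mpr (.inr (.inl rfl)))
  have hc₂ := hpre _ ((adj_out_all_iff hq).mpr (.inr (.inr (.inl rfl))))
  have hx' := hpre _ ((adj_out_all_iff hq).mpr (.inr (.inr (.inr rfl))))
  obtain ⟨tg, h3, h4, hpre', hstay⟩ :=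
    exists_last_placement hP h1 (notMem_of_cnt (hn0 6) (v := .wit i) rfl rfl) hwit
  have hout := hpre' _ ((adj_wit_all_iff hq).mpr (.inl rfl))
  have hd := hpre' _ ((adj_wit_all_iff hq).mpr (.inr (.inl rfl)))
  have hx := hpre' _ ((adj_wit_all_iff hq).mpr (.inr (.inr (.inl rfl))))
  have ha := hpre' _ ((adj_wit_all_iff hq).mpr (.inr (.inr (.inr rfl))))
  -- the first two pyramids are filled in this order
  obtain ⟨τa, a1, a2, -, a3, -, -, a4⟩ := exists_last_pyramid_fill (i := i) (r := 0)
    (F := {Φ.apex i 0}) hP (fun v hv => .inl hv) h3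
    (pyrOpen_of_cnt (hn0 0) (by rintro v rfl; exact notMem_of_cnt (hn0 0) rfl rfl))
    (not_pyrOpen_of_mem rfl ha)
  have hA : ∀ t, τa < t → t ≤ tg → 1 ≤ cnt (P t) i 0 := by
    intro t ht ht'
    rcases exists_mem_of_not_pyrOpen (a3 t ht ht') with h | ⟨x, rfl, hm⟩
    · exact h
    · exact hpos hm rfl rfl
  have b0 := hbud (τa + 1) (by omega) (by omega)
  have hz1 : cnt (P (τa + 1)) i 1 = 0 := by simp only [Fin.val_zero] at a4; omega
  obtain ⟨τd, d1, d2, -, d3, -, -, d4⟩ := exists_last_pyramid_fill (i := i) (r := 1)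
    (F := {Φ.apex i 1}) hP (fun v hv => .inl hv) (show τa + 1 ≤ tg by omega)
    (pyrOpen_of_cnt hz1 (by rintro v rfl; exact notMem_of_cnt hz1 rfl rfl))
    (not_pyrOpen_of_mem rfl hd)
  have hD : ∀ t, τd < t → t ≤ tg → 1 ≤ cnt (P t) i 1 := by
    intro t ht ht'
    rcases exists_mem_of_not_pyrOpen (d3 t ht ht') with h | ⟨x, rfl, hm⟩
    · exact h
    · exact hpos hm rfl rfl
  have b1 := hbud (τd + 1) (by omega) (by omega)
  have b1' := hA (τd + 1) (by omega) (by omega)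
  simp only [Fin.val_one] at d4
  have hz2 : cnt (P (τd + 1)) i 2 = 0 := by omega
  have hz3 : cnt (P (τd + 1)) i 3 = 0 := by omega
  have hopen : PyrOpen i 2 {Φ.apex i 2} (P (τd + 1)) :=
    pyrOpen_of_cnt hz2 (by rintro v rfl; exact notMem_of_cnt hz2 rfl rfl)
  rcases b with _ | _
  · by_cases hcase : PyrOpen i 2 {Φ.apex i 2} (P tg)
    · -- the rest of the graph is pebbled again
      obtain ⟨τc, c1, c2, -, c3, -, -, c4⟩ := exists_last_pyramid_fill (i := i) (r := 2)
        (F := {Φ.apex i 2}) hP (fun v hv => .inl hv) (show tg ≤ t₂ by omega) hcase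
        (not_pyrOpen_of_mem rfl hc₂)
      have hC : ∀ t, τc < t → t ≤ t₂ → 1 ≤ cnt (P t) i 2 := by
        intro t ht ht'
        rcases exists_mem_of_not_pyrOpen (c3 t ht ht') with h | ⟨x, rfl, hm⟩
        · exact h
        · exact hpos hm rfl rfl
      have hG : ∀ t, tg < t → t ≤ t₂ → 1 ≤ cnt (P t) i 6 := fun t ht ht' =>
        hpos (hstay t ht ht') rfl rfl
      -- Otherwise the negative literal, still needed at `t₂`, requires the first pyramid to be
      -- refilled, which leaves no pebble for the witness.
      have hA' : ∀ t, tg < t → t ≤ t₂ → 1 ≤ cnt (P t) i 0 + cnt (P t) i 4 := by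
        intro t ht ht'
        by_contra hcon
        obtain ⟨t₃, f1, f2, f3, -⟩ := exists_last_placement hP ht'
          (notMem_of_cnt (show cnt (P t) i 4 = 0 by omega) rfl rfl) hx'
        obtain ⟨τ, k1, k2, -, -, k3⟩ := exists_pyramid_fill (i := i) (r := 0) hP f1
          (show cnt (P t) i 0 = 0 by omega)
          (f3 _ (adj_lit_iff.mpr (belowLit_all_false hq).symm))
        have k4 := hbud (τ + 1) (by omega) (by omega)
        have k5 := hG (τ + 1) (by omega) (by omega)
        simp only [Fin.val_zero] at k3
        omega
      have b2 := hbud (τc + 1) (by omega) (by omega)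
      have b2' := hA' (τc + 1) (by omega) (by omega)
      have b2'' := hG (τc + 1) (by omega) (by omega)
      simp only [Fin.val_two] at c4
      refine ⟨τc + 1, t₂, by omega, by omega, by omega, blk_lt_of_rest (by omega), hout₂,
        fun t ht ht' => ?_⟩
      have g1 := hC t (by omega) ht'
      have g2 := hG t (by omega) ht'
      have g3 := hA' t (by omega) ht'
      rw [blkCard_eq _ i.2]
      split_ifs with hl
      · have := hpos (l := 3) hl rfl rfl
        omega
      · omega
    · -- the third pyramid has been kept, and neither literal can be used
      obtain ⟨τc, c1, c2, -, c3, -, -, c4⟩ := exists_last_pyramid_fill (i := i) (r := 2)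
        (F := {Φ.apex i 2}) hP (fun v hv => .inl hv) (show τd + 1 ≤ tg by omega) hopen hcase
      have hC : ∀ t, τc < t → t ≤ tg → 1 ≤ cnt (P t) i 2 := by
        intro t ht ht'
        rcases exists_mem_of_not_pyrOpen (c3 t ht ht') with h | ⟨x, rfl, hm⟩
        · exact h
        · exact hpos hm rfl rfl
      have b2 := hbud (τc + 1) (by omega) (by omega)
      have b2' := hA (τc + 1) (by omega) (by omega)
      have b2'' := hD (τc + 1) (by omega) (by omega)
      simp only [Fin.val_two] at c4
      refine ⟨τc + 1, tg, by omega, by omega, by omega, blk_lt_of_rest (by omega), hout,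
        fun t ht ht' => ?_⟩
      have g1 := hA t (by omega) ht'
      have g2 := hD t (by omega) ht'
      have g3 := hC t (by omega) ht'
      rw [blkCard_eq _ i.2]
      split_ifs with hl
      · have := hpos (l := 3) hl rfl rfl
        omega
      · omega
  · obtain ⟨τc, c1, c2, -, c3, -, -, c4⟩ := exists_last_pyramid_fill (i := i) (r := 2)
      (F := {Φ.apex i 2, .lit i true}) hP (by
        rintro v (rfl | rfl)
        · exact .inl rfl
        · exact .inr ⟨Φ.apex i 2, by simp, adj_lit_iff.mpr (belowLit_all_true hq).symm⟩)
      (show τd + 1 ≤ tg by omega)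
      (pyrOpen_of_cnt hz2 (by
        rintro v (rfl | rfl)
        · exact notMem_of_cnt hz2 rfl rfl
        · exact notMem_of_cnt hz3 rfl rfl))
      (not_pyrOpen_of_mem (x := .lit i true) (by simp) hx)
    have hC : ∀ t, τc < t → t ≤ tg → 1 ≤ cnt (P t) i 2 + cnt (P t) i 3 := by
      intro t ht ht'
      rcases exists_mem_of_not_pyrOpen (c3 t ht ht') with h | ⟨x, rfl | rfl, hm⟩
      · exact Nat.le_add_right_of_le h
      · exact Nat.le_add_right_of_le (hpos hm rfl rfl)
      · exact Nat.le_add_left_of_le (hpos hm rfl rfl)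
    have b2 := hbud (τc + 1) (by omega) (by omega)
    have b2' := hA (τc + 1) (by omega) (by omega)
    have b2'' := hD (τc + 1) (by omega) (by omega)
    simp only [Fin.val_two] at c4
    refine ⟨τc + 1, tg, by omega, by omega, by omega, blk_lt_of_rest (by omega), hout,
      fun t ht ht' => ?_⟩
    have g1 := hA t (by omega) ht'
    have g2 := hD t (by omega) ht'
    have g3 := hC t (by omega) ht'
    rw [blkCard_eq _ i.2]
    split_ifs with hl
    · have := hpos (l := 4) hl rfl rfl
      omega
    · omega

/-! ### Clauses, and induction over the blocks -/

/-- The matrix of the formula. -/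
def Matrix (Φ : QCNF) (σ : Fin Φ.numVars → Bool) : Prop :=
  ∀ c ∈ Φ.clauses, ∃ l ∈ c.1, σ l.1 = l.2

/-- If the last clause is checked from scratch, then every clause is checked on the way. -/
theorem exists_chk_placement (hP : ∀ t, BlackMove Φ.gltGraph (P t) (P (t + 1))) {t₀ : ℕ}
    (h₀ : ∀ v ∈ P t₀, blk v < Φ.numVars) (c : Fin Φ.numClauses) (d : ℕ) :
    ∀ (j : Fin (Φ.numClauses + 1)) (t₁ : ℕ), c.val + 1 + d = j.val → t₀ ≤ t₁ → .chk j ∈ P t₁ →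
      ∃ t, t₀ ≤ t ∧ t ≤ t₁ ∧ Vertex.chk c.succ ∈ P t ∧
        ∀ u, Φ.gltGraph.Adj u (.chk c.succ) → u ∈ P t := by
  induction d with
  | zero =>
    intro j t₁ hj ht hm
    obtain rfl : j = c.succ := Fin.ext hj.symm
    obtain ⟨τ, h1, h2, h3, h4⟩ := exists_last_placement hP ht
      (fun hm => lt_irrefl _ (h₀ _ hm)) hm
    have h5 := h4 (τ + 1) (by omega) (by omega)
    rcases hP τ with ⟨v, hv, -⟩ | hs
    · refine ⟨τ + 1, by omega, by omega, h5, fun u hu => ?_⟩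
      rw [hv]
      exact Finset.mem_insert_of_mem (h3 u hu)
    · exact ⟨τ, h1, by omega, hs h5, h3⟩
  | succ d ih =>
    intro j t₁ hj ht hm
    obtain ⟨c', rfl⟩ : ∃ c' : Fin Φ.numClauses, j = c'.succ :=
      ⟨⟨j.val - 1, by omega⟩, Fin.ext (by simp; omega)⟩
    obtain ⟨τ, h1, h2, h3, -⟩ := exists_last_placement hP ht
      (fun hm => lt_irrefl _ (h₀ _ hm)) hm
    obtain ⟨t, k1, k2, k3⟩ := ih c'.castSucc τ (by simp at hj ⊢; omega) h1
      (h3 _ (adj_chk_iff.mpr (.inl rfl)))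
    exact ⟨t, k1, by omega, k3⟩

/-- For a false clause `C`, each of its pebbled literals adds one to the `3n` pebbles of the blocks.
With the `3 - |C|` padding sources and two check vertices this makes `3n + 5`, one too many. -/
theorem matrix_of_pebbled (hP : ∀ t, BlackMove Φ.gltGraph (P t) (P (t + 1)))
    (hK : ∀ t, (P t).card ≤ 3 * Φ.numVars + 4) {t₀ t₁ : ℕ} (h : t₀ ≤ t₁)
    (h₀ : ∀ v ∈ P t₀, blk v < Φ.numVars) (h₁ : .chk (Fin.last _) ∈ P t₁) (σ : Fin Φ.numVars → Bool)
    (hinv : ∀ t, t₀ ≤ t → t ≤ t₁ → ∀ j : Fin Φ.numVars,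
      3 + (if Vertex.lit j (!σ j) ∈ P t then 1 else 0) ≤ blkCard (P t) j) : Φ.Matrix σ := by
  intro C hC
  obtain ⟨c, rfl⟩ : ∃ c : Fin Φ.numClauses, Φ.clauses.get c = C := List.mem_iff_get.mp hC
  by_contra hcon
  push Not at hcon
  obtain ⟨t, h1, h2, h3, h4⟩ := exists_chk_placement hP h₀ c (Φ.numClauses - (c + 1))
    (Fin.last _) t₁ (by simp only [Fin.val_last]; omega) h h₁
  have hfalse : ∀ l ∈ (Φ.clauses.get c).1, l.2 = !σ l.1 := by
    intro l hl
    have := hcon l hl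
    revert this
    cases σ l.1 <;> cases l.2 <;> decide
  have hcard := (Φ.clauses.get c).2
  set J : Finset ℕ := (Φ.clauses.get c).1.image (fun l => l.1.val) with hJ
  -- All literals of the clause are false, so no two of them belong to the same variable.
  have hJcard : J.card = (Φ.clauses.get c).1.card := by
    refine Finset.card_image_of_injOn fun l hl l' hl' he => ?_
    have he' : l.1 = l'.1 := Fin.ext he
    exact Prod.ext he' (by rw [hfalse l hl, hfalse l' hl', he'])
  have hbound := sum_add_rest_le (P := P t) (fun j => 3 + if j ∈ J then 1 else 0) Φ.numVars (by
    intro j hj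
    refine le_trans ?_ (hinv t h1 h2 ⟨j, hj⟩)
    split_ifs with h5 h6
    · exact le_rfl
    · exfalso
      obtain ⟨l, hl, rfl⟩ := Finset.mem_image.mp h5
      refine h6 (h4 _ (adj_chk_iff.mpr (.inr (.inl ⟨l, hl, ?_⟩))))
      rw [hfalse l hl]
    · omega
    · omega)
  have hsum : ∑ j ∈ Finset.range Φ.numVars, (3 + if j ∈ J then 1 else 0) =
      3 * Φ.numVars + (Φ.clauses.get c).1.card := by
    have hJr : J ⊆ Finset.range Φ.numVars := by
      intro j hj
      obtain ⟨l, -, rfl⟩ := Finset.mem_image.mp hj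
      simp
    rw [Finset.sum_add_distrib, ← Finset.card_filter, Finset.filter_mem_eq_inter,
      Finset.inter_eq_right.mpr hJr, hJcard]
    simp [mul_comm]
  have hrest : 5 - (Φ.clauses.get c).1.card ≤ rest (P t) Φ.numVars := by
    have e1 : (Finset.univ.image (fun k => Vertex.pad c k)).card =
        3 - (Φ.clauses.get c).1.card := by
      rw [Finset.card_image_of_injective _ (fun k k' h => eq_of_heq (Vertex.pad.inj h).2)]
      simp
    have e2 : Vertex.chk c.castSucc ∉ Finset.univ.image (fun k => Vertex.pad c k) := by simp
    have e3 : Vertex.chk c.succ ∉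
        insert (Vertex.chk c.castSucc) (Finset.univ.image (fun k => Vertex.pad c k)) := by
      simp only [Finset.mem_insert, Vertex.chk.injEq, Fin.ext_iff, Fin.val_succ, Fin.val_castSucc,
        Finset.mem_image, reduceCtorEq, and_false, exists_false, or_false]
      omega
    have e4 := Finset.card_insert_of_notMem e3
    rw [Finset.card_insert_of_notMem e2, e1] at e4
    have e5 : 5 - (Φ.clauses.get c).1.card ≤ 3 - (Φ.clauses.get c).1.card + 1 + 1 := by omega
    refine e5.trans (e4.ge.trans (Finset.card_le_card ?_))
    intro v hv
    rw [Finset.mem_filter]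
    simp only [Finset.mem_insert, Finset.mem_image, Finset.mem_univ, true_and] at hv
    rcases hv with rfl | rfl | ⟨k, rfl⟩
    · exact ⟨h3, le_rfl⟩
    · exact ⟨h4 _ (adj_chk_iff.mpr (.inl rfl)), le_rfl⟩
    · exact ⟨h4 _ (adj_chk_iff.mpr (.inr (.inr ⟨k, rfl⟩))), le_rfl⟩
  have := hK t
  omega

/-- Pebbling the part of the graph that belongs to `xᵢ, …` from scratch, while the blocks before
it keep three pebbles each, shows that the formula is true from `xᵢ` on. -/
theorem trueFrom_of_pebbled (hP : ∀ t, BlackMove Φ.gltGraph (P t) (P (t + 1)))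
    (hK : ∀ t, (P t).card ≤ 3 * Φ.numVars + 4) (d : ℕ) :
    ∀ (i : ℕ) (_ : i + d = Φ.numVars) (t₀ t₁ : ℕ) (_ : t₀ ≤ t₁) (_ : ∀ v ∈ P t₀, blk v < i)
      (_ : Φ.outFrom i ∈ P t₁) (σ : Fin Φ.numVars → Bool)
      (_ : ∀ t, t₀ ≤ t → t ≤ t₁ → ∀ j : Fin Φ.numVars, j.val < i →
        3 + (if Vertex.lit j (!σ j) ∈ P t then 1 else 0) ≤ blkCard (P t) j),
      TrueFrom Φ.quant Φ.Matrix i σ := by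
  induction d with
  | zero =>
    intro i hi t₀ t₁ h h₀ h₁ σ hinv
    obtain rfl : i = Φ.numVars := hi
    rw [trueFrom_of_le le_rfl]
    rw [outFrom_of_le le_rfl] at h₁
    exact matrix_of_pebbled hP hK h h₀ h₁ σ fun t ht ht' j => hinv t ht ht' j j.2
  | succ d ih =>
    intro i hi t₀ t₁ h h₀ h₁ σ hinv
    have hin : i < Φ.numVars := by omega
    rw [outFrom_of_lt hin] at h₁
    have hbud : ∀ t, t₀ ≤ t → t ≤ t₁ →
        blkCard (P t) i + rest (P t) (i + 1) ≤ 3 * (Φ.numVars - i) + 4 := by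
      intro t ht ht'
      have e1 := sum_add_rest_le (P := P t) (fun _ => 3) i fun j hj =>
        le_trans (Nat.le_add_right _ _) (hinv t ht ht' ⟨j, by omega⟩ hj)
      rw [Finset.sum_const, Finset.card_range, smul_eq_mul, rest_eq] at e1
      have := hK t
      omega
    have step : ∀ b, HasPhase P ⟨i, hin⟩ b t₀ t₁ →
        TrueFrom Φ.quant Φ.Matrix (i + 1) (Function.update σ ⟨i, hin⟩ b) := by
      rintro b ⟨u₀, u₁, e1, e2, e3, e4, e5, e6⟩
      refine ih (i + 1) (by omega) u₀ u₁ e2 e4 e5 _ fun t ht ht' j hj => ?_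
      rcases eq_or_ne j ⟨i, hin⟩ with rfl | hne
      · rw [Function.update_self]
        exact e6 t ht ht'
      · rw [Function.update_of_ne hne]
        have : j.val ≠ i := fun e => hne (Fin.ext e)
        exact hinv t (by omega) (by omega) j (by omega)
    rcases hq : Φ.quant ⟨i, hin⟩ with _ | _
    · rw [trueFrom_all hin hq]
      exact fun b => step b (hasPhase_all hq hP h h₀ h₁ hbud b)
    · rw [trueFrom_ex hin hq]
      obtain ⟨b, hb⟩ := hasPhase_ex hq hP h h₀ h₁ hbud
      exact ⟨b, step b hb⟩

theorem isTrue_of_pebbled (hP : ∀ t, BlackMove Φ.gltGraph (P t) (P (t + 1)))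
    (hK : ∀ t, (P t).card ≤ 3 * Φ.numVars + 4) (h₀ : P 0 = ∅) {t : ℕ} (ht : Φ.outFrom 0 ∈ P t) :
    Φ.IsTrue :=
  (quantTrue_iff_trueFrom fun _ => false).mpr <|
    trueFrom_of_pebbled hP hK Φ.numVars 0 (by omega) 0 t (by omega) (by simp [h₀]) ht _ (by simp)

end QCNF

/-! ### A true formula gives a pebbling strategy -/

namespace QCNF

variable {Φ : QCNF}

/-- Below this position hangs a pyramid of size `d + 1`. One predecessor is pebbled and held while
the other is pebbled, so each row costs one more pebble. -/
theorem reach_pyrGrid (i : Fin Φ.numVars) (r : Fin 3) (d : ℕ) :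
    ∀ a b, a + b + (d + 1) = Φ.pyramidSize i r →
      BlackReach Φ.gltGraph (d + 2) ∅ {pyrGrid i r a b} := by
  induction d with
  | zero =>
    intro a b h
    refine .place (P := ∅) (fun u hu => ?_) (by simp)
    rw [pyrGrid, dif_pos (by omega), adj_pyr_iff] at hu
    obtain ⟨w, ⟨h1, h2⟩ | ⟨h1, h2⟩, -⟩ := hu
    · have := w.2
      rw [Fin.ext_iff] at h2
      simp only at h1 h2
      omega
    · have := w.2
      rw [Fin.ext_iff] at h1
      simp only at h1 h2
      omega
  | succ d ih =>
    intro a b h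
    have e1 := (ih (a + 1) b (by omega)).mono (show d + 2 ≤ d + 1 + 2 by omega)
    have e2 := (ih a (b + 1) (by omega)).frame (k := d + 1 + 2) {pyrGrid i r (a + 1) b} (by simp)
    rw [Finset.empty_union] at e2
    refine e1.trans (e2.trans (.trans (.place (v := pyrGrid i r a b) (fun u hu => ?_) ?_)
      (.drop (by simp) (by simp))))
    · rw [pyrGrid, dif_pos (by omega), adj_pyr_iff] at hu
      obtain ⟨⟨⟨⟨x, hx⟩, ⟨y, hy⟩⟩, hw⟩, ⟨h1, h2⟩ | ⟨h1, h2⟩, rfl⟩ := hu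
      · rw [Fin.ext_iff] at h2
        simp only at h1 h2
        subst h1 h2
        rw [pyrGrid, pyrGrid, dif_pos (by omega), dif_pos (by omega)]
        simp
      · rw [Fin.ext_iff] at h1
        simp only at h1 h2
        subst h1 h2
        rw [pyrGrid, pyrGrid, dif_pos (by omega), dif_pos (by omega)]
        simp
    · have := Finset.card_le_two (a := pyrGrid i r a (b + 1)) (b := pyrGrid i r (a + 1) b)
      rw [← Finset.insert_eq]
      omega

/-- The configuration that consists of a list of vertices and a fixed set of vertices. -/
def pebbleSet (H : Finset Φ.Vertex) (l : List Φ.Vertex) : Finset Φ.Vertex := l.toFinset ∪ H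

theorem card_pebbleSet_le (H : Finset Φ.Vertex) (l : List Φ.Vertex) :
    (pebbleSet H l).card ≤ l.length + H.card :=
  (Finset.card_union_le _ _).trans (Nat.add_le_add_right l.toFinset_card_le _)

theorem pebbleSet_cons (H : Finset Φ.Vertex) (v : Φ.Vertex) (l : List Φ.Vertex) :
    pebbleSet H (v :: l) = insert v (pebbleSet H l) := by
  simp [pebbleSet]

variable {H : Finset Φ.Vertex} {k : ℕ}

theorem reach_place {v : Φ.Vertex} {l : List Φ.Vertex}
    (h : ∀ u, Φ.gltGraph.Adj u v → u ∈ l) (hk : l.length + 1 + H.card ≤ k) :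
    BlackReach Φ.gltGraph k (pebbleSet H l) (pebbleSet H (v :: l)) := by
  rw [pebbleSet_cons]
  have := card_pebbleSet_le H l
  exact .place (fun u hu => Finset.mem_union_left _ (List.mem_toFinset.mpr (h u hu))) (by omega)

theorem reach_drop {l l' : List Φ.Vertex} (h : l' ⊆ l) (hk : l'.length + H.card ≤ k) :
    BlackReach Φ.gltGraph k (pebbleSet H l) (pebbleSet H l') :=
  .drop (Finset.union_subset_union_left fun _ hx =>
    List.mem_toFinset.mpr (h (List.mem_toFinset.mp hx))) ((card_pebbleSet_le H l').trans hk)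

theorem reach_apex (i : Fin Φ.numVars) (r : Fin 3) (l : List Φ.Vertex)
    (hk : l.length + (Φ.pyramidSize i r + 1) + H.card ≤ k) :
    BlackReach Φ.gltGraph k (pebbleSet H l) (pebbleSet H (Φ.apex i r :: l)) := by
  have hs := Φ.pyramidSize_pos i r
  have h1 := card_pebbleSet_le H l
  have h := (reach_pyrGrid i r (Φ.pyramidSize i r - 1) 0 0 (by omega)).frame (k := k) (pebbleSet H l)
    (by omega)
  rwa [pyrGrid_zero, Finset.empty_union, ← Finset.insert_eq, ← pebbleSet_cons] at h

/-- `H` carries at most three pebbles for each variable before `xᵢ`, among them the literal that is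
true under `σ` and the vertex below the other literal. -/
structure Holds (Φ : QCNF) (i : ℕ) (σ : Fin Φ.numVars → Bool) (H : Finset Φ.Vertex) : Prop where
  card : H.card ≤ 3 * i
  lit : ∀ j : Fin Φ.numVars, j.val < i → .lit j (σ j) ∈ H
  below : ∀ j : Fin Φ.numVars, j.val < i → Φ.belowLit j (!σ j) ∈ H

theorem Holds.extend {i : ℕ} {σ : Fin Φ.numVars → Bool} (h : Holds Φ i σ H)
    (hi : i < Φ.numVars) (b : Bool) {l : List Φ.Vertex} (hl : l.length = 3)
    (h1 : .lit ⟨i, hi⟩ b ∈ l) (h2 : Φ.belowLit ⟨i, hi⟩ (!b) ∈ l) :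
    Holds Φ (i + 1) (Function.update σ ⟨i, hi⟩ b) (pebbleSet H l) := by
  refine ⟨?_, fun j hj => ?_, fun j hj => ?_⟩
  · have := card_pebbleSet_le H l
    have := h.card
    omega
  · rcases eq_or_ne j ⟨i, hi⟩ with rfl | hne
    · rw [Function.update_self]
      exact Finset.mem_union_left _ (List.mem_toFinset.mpr h1)
    · rw [Function.update_of_ne hne]
      have : j.val ≠ i := fun e => hne (Fin.ext e)
      exact Finset.mem_union_right _ (h.lit j (by omega))
  · rcases eq_or_ne j ⟨i, hi⟩ with rfl | hne
    · rw [Function.update_self]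
      exact Finset.mem_union_left _ (List.mem_toFinset.mpr h2)
    · rw [Function.update_of_ne hne]
      have : j.val ≠ i := fun e => hne (Fin.ext e)
      exact Finset.mem_union_right _ (h.below j (by omega))

/-- At most four pebbles are free besides `H`. They go to two consecutive check vertices and at most
two inputs, because a satisfied literal of the clause is already in `H`. A false literal takes one
move, as the vertex below it is in `H`. -/
theorem reach_chk {σ : Fin Φ.numVars → Bool} (hH : Holds Φ Φ.numVars σ H) (hσ : Φ.Matrix σ)
    (j : ℕ) (hj : j < Φ.numClauses + 1) :
    BlackReach Φ.gltGraph (3 * Φ.numVars + 4) H (insert (.chk ⟨j, hj⟩) H) := by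
  have hcard := hH.card
  induction j with
  | zero => exact .place (fun u hu => absurd hu not_adj_chk_zero) (by omega)
  | succ j ih =>
    let c : Fin Φ.numClauses := ⟨j, by omega⟩
    obtain ⟨l₀, hl₀, hσl⟩ := hσ _ (List.get_mem Φ.clauses c)
    have h0 : Vertex.lit l₀.1 l₀.2 ∈ H := hσl ▸ hH.lit l₀.1 l₀.1.2
    let W : Finset Φ.Vertex := (((Φ.clauses.get c).1.erase l₀).image fun l => .lit l.1 l.2) ∪
      Finset.univ.image (fun k => .pad c k)
    have hW : W.card ≤ 2 := by
      refine (Finset.card_union_le _ _).trans ((Nat.add_le_add Finset.card_image_le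
        Finset.card_image_le).trans ?_)
      rw [Finset.card_erase_of_mem hl₀, Finset.card_univ, Fintype.card_fin]
      have := (Φ.clauses.get c).2
      have := Finset.card_pos.mpr ⟨l₀, hl₀⟩
      omega
    have h1 := Finset.card_insert_le (Vertex.chk ⟨j, by omega⟩) H
    have h2 := Finset.card_union_le W (insert (Vertex.chk ⟨j, by omega⟩) H)
    refine (ih (by omega)).trans ((BlackReach.place_all W ?_ (by omega)).trans
      ((BlackReach.place (v := .chk c.succ) ?_ (by omega)).trans (.drop ?_ ?_)))
    · intro w hw
      rcases Finset.mem_union.mp hw with hw | hw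
      · obtain ⟨⟨x, b⟩, hl, rfl⟩ := Finset.mem_image.mp hw
        by_cases hb : σ x = b
        · exact .inl (Finset.mem_insert_of_mem (hb ▸ hH.lit x x.2))
        · refine .inr fun u hu => Finset.mem_insert_of_mem ?_
          have hb' : b = !σ x := by revert hb; cases σ x <;> cases b <;> decide
          rw [adj_lit_iff] at hu
          rw [hu]
          simp only [hb']
          exact hH.below x x.2
      · obtain ⟨k, -, rfl⟩ := Finset.mem_image.mp hw
        exact .inr fun u hu => absurd hu not_adj_pad
    · intro u hu
      rcases adj_chk_iff.mp hu with rfl | ⟨l, hl, rfl⟩ | ⟨k, rfl⟩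
      · exact Finset.mem_union_right _ (Finset.mem_insert_self _ _)
      · by_cases hll : l = l₀
        · subst hll
          exact Finset.mem_union_right _ (Finset.mem_insert_of_mem h0)
        · exact Finset.mem_union_left _ (Finset.mem_union_left _ (Finset.mem_image.mpr
            ⟨l, Finset.mem_erase.mpr ⟨hll, hl⟩, rfl⟩))
      · exact Finset.mem_union_left _ (Finset.mem_union_right _ (Finset.mem_image.mpr
          ⟨k, Finset.mem_univ _, rfl⟩))
    · exact Finset.insert_subset_insert _ ((Finset.subset_insert _ _).trans
        Finset.subset_union_right)
    · exact (Finset.card_insert_le _ _).trans (by omega)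

/-- Three pebbles per block suffice during the recursion: the true literal, the vertex below the
false one, and one more for the progress of the block. The pyramids are filled in order of
decreasing size, each with exactly the pebbles still available when `H` has `3i`. -/
theorem reach_of_trueFrom (d : ℕ) : ∀ (i : ℕ) (_ : i + d = Φ.numVars) (σ : Fin Φ.numVars → Bool)
    (H : Finset Φ.Vertex) (_ : Holds Φ i σ H) (_ : TrueFrom Φ.quant Φ.Matrix i σ),
    BlackReach Φ.gltGraph (3 * Φ.numVars + 4) H (insert (Φ.outFrom i) H) := by
  induction d with
  | zero =>
    intro i hi σ H hH ht
    obtain rfl : i = Φ.numVars := hi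
    rw [trueFrom_of_le le_rfl] at ht
    rw [outFrom_of_le le_rfl]
    exact reach_chk hH ht _ _
  | succ d ih =>
    intro i hi σ H hH ht
    have hin : i < Φ.numVars := by omega
    have hcard := hH.card
    set x : Fin Φ.numVars := ⟨i, hin⟩ with hx
    have hs0 : Φ.pyramidSize x 0 = 3 * (Φ.numVars - i) + 3 := pyramidSize_zero x
    have hs1 : Φ.pyramidSize x 1 = 3 * (Φ.numVars - i) + 2 := pyramidSize_one x
    have hs2 : Φ.pyramidSize x 2 = 3 * (Φ.numVars - i) + 1 := pyramidSize_two x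
    have hrec : ∀ b (l : List Φ.Vertex), l.length = 3 → .lit x b ∈ l → Φ.belowLit x (!b) ∈ l →
        TrueFrom Φ.quant Φ.Matrix (i + 1) (Function.update σ x b) →
        BlackReach Φ.gltGraph (3 * Φ.numVars + 4) (pebbleSet H l)
          (pebbleSet H (Φ.outFrom (i + 1) :: l)) := by
      intro b l h1 h2 h3 h4
      rw [pebbleSet_cons]
      exact ih (i + 1) (by omega) _ _ (hH.extend hin b h1 h2 h3) h4
    have hstart : BlackReach Φ.gltGraph (3 * Φ.numVars + 4) (pebbleSet H [])
        (pebbleSet H [Φ.apex x 2, Φ.apex x 1, Φ.apex x 0]) :=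
      (reach_apex x 0 _ (by simp only [List.length_nil]; omega)).trans
        ((reach_apex x 1 _ (by simp only [List.length_cons, List.length_nil]; omega)).trans
          (reach_apex x 2 _ (by simp only [List.length_cons, List.length_nil]; omega)))
    suffices h : BlackReach Φ.gltGraph (3 * Φ.numVars + 4) (pebbleSet H []) (pebbleSet H [.out x]) by
      rw [outFrom_of_lt hin]
      rwa [pebbleSet_cons, show pebbleSet H [] = H by simp [pebbleSet]] at h
    refine hstart.trans ?_
    rcases hq : Φ.quant x with _ | _
    · rw [trueFrom_all hin hq] at ht
      have hbt := belowLit_all_true hq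
      have hbf := belowLit_all_false hq
      refine (reach_place (v := .lit x true) (by simp [adj_lit_iff, hbt]) ?_).trans ?_
      · simp only [List.length_cons, List.length_nil]; omega
      refine (reach_drop (l' := [.lit x true, Φ.apex x 1, Φ.apex x 0]) (by simp) ?_).trans ?_
      · simp only [List.length_cons, List.length_nil]; omega
      refine (hrec true _ rfl (by simp) (by simp [hbf]) (ht true)).trans ?_
      refine (reach_place (v := .wit x) ?_ ?_).trans ?_
      · intro u hu
        rcases (adj_wit_all_iff hq).mp hu with rfl | rfl | rfl | rfl <;> simp [hx]
      · simp only [List.length_cons, List.length_nil]; omega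
      -- The witness records the finished pass for `true`. The first apex yields the negative
      -- literal, and two pebbles leave just enough room to refill the third pyramid.
      refine (reach_drop (l' := [.wit x, Φ.apex x 0]) (by simp) ?_).trans ?_
      · simp only [List.length_cons, List.length_nil]; omega
      refine (reach_place (v := .lit x false) (by simp [adj_lit_iff, hbf]) ?_).trans ?_
      · simp only [List.length_cons, List.length_nil]; omega
      refine (reach_drop (l' := [.lit x false, .wit x]) (by simp) ?_).trans ?_
      · simp only [List.length_cons, List.length_nil]; omega
      refine (reach_apex x 2 _ ?_).trans ?_
      · simp only [List.length_cons, List.length_nil]; omega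
      refine (hrec false _ rfl (by simp) (by simp [hbt]) (ht false)).trans ?_
      refine (reach_place (v := .out x) ?_ ?_).trans (reach_drop (by simp) ?_)
      · intro u hu
        rcases (adj_out_all_iff hq).mp hu with rfl | rfl | rfl | rfl <;> simp [hx]
      · simp only [List.length_cons, List.length_nil]; omega
      · simp only [List.length_cons, List.length_nil]; omega
    · rw [trueFrom_ex hin hq] at ht
      have hbt := belowLit_ex_true hq
      have hbf := belowLit_ex_false hq
      obtain ⟨b, ht⟩ := ht
      refine (reach_place (v := .bar x hq) (by simp [adj_bar_iff]) ?_).trans ?_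
      · simp only [List.length_cons, List.length_nil]; omega
      rcases b with _ | _
      · refine (reach_place (v := .lit x false) (by simp [adj_lit_iff, hbf]) ?_).trans ?_
        · simp only [List.length_cons, List.length_nil]; omega
        refine (reach_drop (l' := [.lit x false, Φ.apex x 1, Φ.apex x 0]) (by simp) ?_).trans ?_
        · simp only [List.length_cons, List.length_nil]; omega
        refine (hrec false _ rfl (by simp) (by simp [hbt]) ht).trans ?_
        refine (reach_place (v := .lit x true) (by simp [adj_lit_iff, hbt]) ?_).trans ?_
        · simp only [List.length_cons, List.length_nil]; omega
        refine (reach_place (v := .wit x) ?_ ?_).trans ?_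
        · intro u hu
          rcases (adj_wit_ex_iff hq).mp hu with rfl | rfl | rfl | rfl <;> simp [hx]
        · simp only [List.length_cons, List.length_nil]; omega
        refine (reach_drop (l' := [.wit x, Φ.apex x 0]) (by simp) ?_).trans ?_
        · simp only [List.length_cons, List.length_nil]; omega
        refine (reach_apex x 2 _ ?_).trans ?_
        · simp only [List.length_cons, List.length_nil]; omega
        refine (reach_place (v := .bar x hq) (by simp [adj_bar_iff]) ?_).trans ?_
        · simp only [List.length_cons, List.length_nil]; omega
        refine (reach_place (v := .out x) (by simp [adj_out_ex_iff hq]) ?_).trans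
          (reach_drop (by simp) ?_)
        · simp only [List.length_cons, List.length_nil]; omega
        · simp only [List.length_cons, List.length_nil]; omega
      · refine (reach_place (v := .lit x true) (by simp [adj_lit_iff, hbt]) ?_).trans ?_
        · simp only [List.length_cons, List.length_nil]; omega
        -- For the value `true`, keeping `bar` yields both the negative literal and the output, so
        -- no pyramid is refilled.
        refine (reach_drop (l' := [.lit x true, .bar x hq, Φ.apex x 1]) (by simp) ?_).trans ?_
        · simp only [List.length_cons, List.length_nil]; omega
        refine (hrec true _ rfl (by simp) (by simp [hbf]) ht).trans ?_
        refine (reach_place (v := .lit x false) (by simp [adj_lit_iff, hbf]) ?_).trans ?_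
        · simp only [List.length_cons, List.length_nil]; omega
        refine (reach_place (v := .wit x) ?_ ?_).trans ?_
        · intro u hu
          rcases (adj_wit_ex_iff hq).mp hu with rfl | rfl | rfl | rfl <;> simp [hx]
        · simp only [List.length_cons, List.length_nil]; omega
        refine (reach_drop (l' := [.wit x, .bar x hq]) (by simp) ?_).trans ?_
        · simp only [List.length_cons, List.length_nil]; omega
        refine (reach_place (v := .out x) (by simp [adj_out_ex_iff hq]) ?_).trans
          (reach_drop (by simp) ?_)
        · simp only [List.length_cons, List.length_nil]; omega
        · simp only [List.length_cons, List.length_nil]; omega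

theorem reach_of_isTrue (h : Φ.IsTrue) :
    BlackReach Φ.gltGraph (3 * Φ.numVars + 4) ∅ {Φ.outFrom 0} :=
  reach_of_trueFrom Φ.numVars 0 (by omega) (fun _ => false) ∅ ⟨by simp, by simp, by simp⟩
    ((quantTrue_iff_trueFrom fun _ => false).mp h)

end QCNF

/-! ### From the black to the spooky pebble game -/

section Spooky

variable {V : Type*} [DecidableEq V] {G : Digraph V} {k : ℕ}

/-- Reachability in the spooky pebble game with at most `k` pebbles; the configurations are pairs
of pebbles and ghosts. -/
def SpookyReach (G : Digraph V) (k : ℕ) : Finset V × Finset V → Finset V × Finset V → Prop :=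
  Relation.ReflTransGen (fun X Y => SpookyMove G X.1 X.2 Y.1 Y.2 ∧ Y.1.card ≤ k)

theorem SpookyReach.trans {X Y Z : Finset V × Finset V} (h : SpookyReach G k X Y)
    (h' : SpookyReach G k Y Z) : SpookyReach G k X Z :=
  Relation.ReflTransGen.trans h h'

theorem SpookyReach.exists_sequence {X Y : Finset V × Finset V} (h : SpookyReach G k X Y)
    (hX : X.1.card ≤ k) : ∃ (T : ℕ) (P S : ℕ → Finset V), P 0 = X.1 ∧ S 0 = X.2 ∧ P T = Y.1 ∧
      S T = Y.2 ∧ (∀ t < T, SpookyMove G (P t) (S t) (P (t + 1)) (S (t + 1))) ∧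
      ∀ t ≤ T, (P t).card ≤ k := by
  induction h with
  | refl =>
    exact ⟨0, fun _ => X.1, fun _ => X.2, rfl, rfl, rfl, rfl, by simp, fun _ _ => hX⟩
  | @tail Y Z _ hYZ ih =>
    obtain ⟨T, P, S, h1, h2, h3, h4, h5, h6⟩ := ih
    refine ⟨T + 1, fun t => if t ≤ T then P t else Z.1, fun t => if t ≤ T then S t else Z.2,
      by simp [h1], by simp [h2], by simp, by simp, fun t ht => ?_, fun t ht => ?_⟩
    · rcases Nat.lt_or_ge t T with h | h
      · simp only [h.le, Nat.succ_le_of_lt h, if_true]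
        exact h5 t h
      · obtain rfl : t = T := by omega
        simpa [h3, h4] using hYZ.1
    · simp only
      split_ifs with h
      · exact h6 t h
      · exact hYZ.2

theorem SpookyReach.pebble {P S : Finset V} {v : V} (h : ∀ u, G.Adj u v → u ∈ P)
    (hk : (insert v P).card ≤ k) : SpookyReach G k (P, S) (insert v P, S) :=
  .single ⟨⟨v, .inl ⟨by rw [Finset.union_comm, Finset.insert_eq], rfl, h⟩⟩, hk⟩

theorem SpookyReach.unghost {P S : Finset V} {v : V} (h : ∀ u, G.Adj u v → u ∈ P)
    (hk : (insert v P).card ≤ k) : SpookyReach G k (P, S) (insert v P, S \ {v}) :=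
  .single ⟨⟨v, .inr (.inr (.inr ⟨by rw [Finset.union_comm, Finset.insert_eq], rfl, h⟩))⟩, hk⟩

theorem SpookyReach.unpebble {P S : Finset V} {v : V} (h : ∀ u, G.Adj u v → u ∈ P)
    (hk : (P \ {v}).card ≤ k) : SpookyReach G k (P, S) (P \ {v}, S) :=
  .single ⟨⟨v, .inr (.inl ⟨rfl, rfl, h⟩)⟩, hk⟩

theorem SpookyReach.ghost_all {P S : Finset V} (D : Finset V) (hk : P.card ≤ k) :
    SpookyReach G k (P, S) (P \ D, S ∪ D) := by
  induction D using Finset.induction_on with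
  | empty => simp only [Finset.sdiff_empty, Finset.union_empty]; exact .refl
  | insert v D _ ih =>
    refine ih.trans (.single ⟨⟨v, .inr (.inr (.inl ⟨?_, ?_⟩))⟩, ?_⟩)
    · simp only
      rw [Finset.sdiff_sdiff_left', Finset.insert_eq, Finset.union_comm {v} D]
      ext; simp; tauto
    · simp only
      rw [Finset.insert_eq, Finset.union_comm {v} D, Finset.union_assoc]
    · exact (Finset.card_le_card Finset.sdiff_subset).trans hk

/-- Remove pebbles, leaving ghosts. -/
theorem SpookyReach.ghost {P P' S : Finset V} (h : P' ⊆ P) (hk : P.card ≤ k) :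
    SpookyReach G k (P, S) (P', S ∪ (P \ P')) := by
  have := SpookyReach.ghost_all (G := G) (S := S) (P \ P') hk
  rwa [Finset.sdiff_sdiff_eq_self h] at this

/-- The black pebble game can be played on a set of vertices that is closed under predecessors
while other pebbles stay; removed pebbles become ghosts. -/
theorem BlackReach.spooky {r : ℕ} {Q Q' : Finset V} (h : BlackReach G r Q Q')
    (hQ : Q.card ≤ r) (A H : Finset V) (hA : ∀ u v, G.Adj u v → v ∈ A → u ∈ A)
    (hk : r + H.card ≤ k) (S : Finset V) :
    Q'.card ≤ r ∧ ∃ S', SpookyReach G k (Q ∩ A ∪ H, S) (Q' ∩ A ∪ H, S') ∧ S' ⊆ S ∪ A := by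
  induction h with
  | refl => exact ⟨hQ, S, .refl, Finset.subset_union_left⟩
  | @tail Q₁ Q₂ _ hm ih =>
    obtain ⟨hc, S', h1, h2⟩ := ih
    obtain ⟨hm, hc'⟩ := hm
    have hbound : ∀ R : Finset V, R.card ≤ r → (R ∩ A ∪ H).card ≤ k := fun R hR =>
      (Finset.card_union_le _ _).trans
        ((Nat.add_le_add_right ((Finset.card_le_card Finset.inter_subset_left).trans hR) _).trans hk)
    refine ⟨hc', ?_⟩
    rcases hm with ⟨v, rfl, hv⟩ | hs
    · by_cases hvA : v ∈ A
      · have e : insert v Q₁ ∩ A ∪ H = insert v (Q₁ ∩ A ∪ H) := by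
          rw [Finset.insert_inter_of_mem hvA, Finset.insert_union]
        refine ⟨S', h1.trans ?_, h2⟩
        rw [e]
        refine .pebble (fun u hu => ?_) (e ▸ hbound _ hc')
        exact Finset.mem_union_left _ (Finset.mem_inter.mpr ⟨hv u hu, hA u v hu hvA⟩)
      · rw [Finset.insert_inter_of_notMem hvA]
        exact ⟨S', h1, h2⟩
    · refine ⟨_, h1.trans (.ghost (Finset.union_subset_union_left
        (Finset.inter_subset_inter_right hs)) (hbound _ hc)), ?_⟩
      refine Finset.union_subset h2 fun x hx => Finset.mem_union_right _ ?_
      simp only [Finset.mem_sdiff, Finset.mem_union, Finset.mem_inter] at hx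
      tauto

/-! ### Pebbling the output and clearing the ghosts -/

/-- A pebble can be placed on `v` with at most `k` pebbles. -/
def CanPlace (G : Digraph V) (k : ℕ) (v : V) : Prop :=
  ∃ P, BlackReach G k ∅ P ∧ (∀ u, G.Adj u v → u ∈ P) ∧ (insert v P).card ≤ k

theorem BlackReach.canPlace {P : Finset V} (h : BlackReach G k ∅ P) {v : V} (hv : v ∈ P) :
    CanPlace G k v := by
  induction h with
  | refl => simp at hv
  | @tail Q₁ Q₂ h hm ih =>
    obtain ⟨⟨w, rfl, hw⟩ | hs, hc⟩ := hm
    · rcases Finset.mem_insert.mp hv with rfl | hv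
      · exact ⟨Q₁, h, hw, hc⟩
      · exact ih hv
    · exact ih (hs hv)

/-- A placement on a vertex needs its predecessors pebbled, and each of these pebbles was itself
placed earlier within the same bound. -/
theorem CanPlace.of_reaches {u v : V} (h : CanPlace G k v)
    (huv : Relation.ReflTransGen G.Adj u v) : CanPlace G k u := by
  induction huv using Relation.ReflTransGen.head_induction_on with
  | refl => exact h
  | head huw _ ih =>
    obtain ⟨P, h1, h2, -⟩ := ih
    exact h1.canPlace (h2 _ huw)

/-- Ghosts can be removed from the top to the bottom while the output stays pebbled. -/
theorem exists_clear {o : V} (f : V → ℕ) (hf : ∀ u v, G.Adj u v → f u < f v)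
    (hplace : ∀ v, v ≠ o → CanPlace G k v) (n : ℕ) : ∀ (A S : Finset V), A.card = n → o ∉ A →
      (∀ u v, G.Adj u v → v ∈ A → u ∈ A) → S ⊆ A → SpookyReach G (k + 1) ({o}, S) ({o}, ∅) := by
  induction n with
  | zero =>
    intro A S hA _ _ hS
    rw [Finset.card_eq_zero] at hA
    obtain rfl : S = ∅ := Finset.subset_empty.mp (hA ▸ hS)
    exact .refl
  | succ n ih =>
    intro A S hA ho hcl hS
    -- A vertex of largest rank precedes no vertex of `A`, so `A.erase v` is still closed under
    -- predecessors.
    obtain ⟨v, hv, hmax⟩ := A.exists_max_image f (Finset.card_pos.mp (by omega))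
    have hcl' : ∀ u w, G.Adj u w → w ∈ A.erase v → u ∈ A.erase v := by
      intro u w huw hw
      have hw' := Finset.mem_of_mem_erase hw
      refine Finset.mem_erase.mpr ⟨?_, hcl u w huw hw'⟩
      rintro rfl
      have := hmax w hw'
      have := hf _ _ huw
      omega
    have hvo : v ≠ o := fun h => ho (h ▸ hv)
    obtain ⟨P, h1, h2, h3⟩ := hplace v hvo
    -- A strategy for `v` is replayed below `v` with `o` standing aside. Then `v` is unghosted and
    -- properly unpebbled; all new ghosts lie in `A.erase v`.
    obtain ⟨h4, S', h5, h6⟩ := h1.spooky (by simp) (A.erase v) {o} hcl' (k := k + 1) (by simp) S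
    rw [Finset.empty_inter, Finset.empty_union] at h5
    set R := P ∩ A.erase v ∪ {o} with hR
    have hpred : ∀ u, G.Adj u v → u ∈ R := by
      intro u hu
      refine Finset.mem_union_left _ (Finset.mem_inter.mpr ⟨h2 u hu, Finset.mem_erase.mpr
        ⟨?_, hcl u v hu hv⟩⟩)
      rintro rfl
      exact lt_irrefl _ (hf _ _ hu)
    have hvR : v ∉ R := by simp [hR, hvo]
    have hRc : (insert v R).card ≤ k + 1 := by
      rw [hR, ← Finset.insert_union]
      refine (Finset.card_union_le _ _).trans (Nat.add_le_add ((Finset.card_le_card ?_).trans h3)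
        (by simp))
      exact Finset.insert_subset_insert _ Finset.inter_subset_left
    have hRc' : R.card ≤ k + 1 := (Finset.card_le_card (Finset.subset_insert _ _)).trans hRc
    have e : insert v R \ {v} = R := by
      rw [Finset.sdiff_singleton_eq_erase, Finset.erase_insert hvR]
    have h7 : SpookyReach G (k + 1) (insert v R, S' \ {v}) (R, S' \ {v}) := by
      have := SpookyReach.unpebble (G := G) (P := insert v R) (S := S' \ {v}) (v := v) (k := k + 1)
        (fun u hu => Finset.mem_insert_of_mem (hpred u hu)) (by rwa [e])
      rwa [e] at this
    refine h5.trans ((SpookyReach.unghost hpred hRc).trans (h7.trans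
      ((SpookyReach.ghost (P' := {o}) (by simp [hR]) hRc').trans
      (ih (A.erase v) _ (by rw [Finset.card_erase_of_mem hv]; omega)
        (fun h => ho (Finset.mem_of_mem_erase h)) hcl' ?_))))
    intro x hx
    simp only [hR, Finset.mem_union, Finset.mem_sdiff, Finset.mem_singleton, Finset.mem_inter] at hx
    rcases hx with ⟨hx, hxv⟩ | ⟨⟨_, hx⟩ | hx, hx'⟩
    · rcases Finset.mem_union.mp (h6 hx) with hx | hx
      · exact Finset.mem_erase.mpr ⟨hxv, hS hx⟩
      · exact hx
    · exact hx
    · exact absurd hx hx'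

/-- If the output of a graph can be pebbled with `k + 1` pebbles, and every other vertex with `k`
pebbles, then the graph can be spooky pebbled with `k + 1` pebbles. -/
theorem spookyPebblable_of_canPlace [Finite V] {o : V} (ho : ∀ v, G.IsRoot v ↔ v = o) (f : V → ℕ)
    (hf : ∀ u v, G.Adj u v → f u < f v) (hplace : ∀ v, v ≠ o → CanPlace G k v)
    (hplace' : CanPlace G (k + 1) o) : SpookyPebblable G (k + 1) := by
  have := Fintype.ofFinite V
  set A : Finset V := Finset.univ.erase o
  have hA : ∀ u v, G.Adj u v → v ∈ A → u ∈ A := by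
    intro u v huv _
    refine Finset.mem_erase.mpr ⟨?_, Finset.mem_univ _⟩
    rintro rfl
    exact (ho u).mpr rfl v huv
  have hreach : SpookyReach G (k + 1) (∅, ∅) ({o}, ∅) := by
    obtain ⟨P, h1, h2, h3⟩ := hplace'
    obtain ⟨h4, S', h5, h6⟩ := h1.spooky (by simp) A ∅ hA (k := k + 1) (by simp) ∅
    rw [Finset.empty_inter, Finset.empty_union, Finset.union_empty] at h5
    have hc : (insert o (P ∩ A)).card ≤ k + 1 :=
      (Finset.card_le_card (Finset.insert_subset_insert _ Finset.inter_subset_left)).trans h3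
    refine h5.trans ((SpookyReach.pebble (v := o) (fun u hu => Finset.mem_inter.mpr
      ⟨h2 u hu, ?_⟩) hc).trans ((SpookyReach.ghost (P' := {o}) (by simp) hc).trans
        (exists_clear f hf hplace _ A _ rfl (by simp [A]) hA ?_)))
    · refine Finset.mem_erase.mpr ⟨?_, Finset.mem_univ _⟩
      rintro rfl
      exact lt_irrefl _ (hf _ _ hu)
    · rw [Finset.empty_union] at h6
      refine Finset.union_subset h6 fun x hx => ?_
      simp only [Finset.mem_sdiff, Finset.mem_insert, Finset.mem_inter, Finset.mem_singleton] at hx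
      tauto
  obtain ⟨T, P, S, h1, h2, h3, h4, h5, h6⟩ := hreach.exists_sequence (by simp)
  exact ⟨T, P, S, ⟨h1, h2, fun v => by rw [h3, ho]; simp, h4, h5⟩, h6⟩

/-! The diamond -/

/-- Pebble a rectangular grid row by row. -/
theorem reach_rectangle {φ : ℕ → ℕ → V} {m c : ℕ}
    (hφ : ∀ a b, a ≤ m → b ≤ c → ¬ (a = 0 ∧ b = 0) → ∀ u, G.Adj u (φ a b) →
      (∃ a', a = a' + 1 ∧ u = φ a' b) ∨ ∃ b', b = b' + 1 ∧ u = φ a b') :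
    BlackReach G (c + 2) {φ 0 0} {φ m c} := by
  have hfirst : ∀ j ≤ c, BlackReach G (c + 2) {φ 0 0} ((Finset.range (j + 1)).image (φ 0)) := by
    intro j
    induction j with
    | zero => intro _; simpa using .refl
    | succ j ih =>
      intro hj
      refine (ih (by omega)).trans ?_
      rw [Finset.range_add_one (n := j + 1), Finset.image_insert]
      refine .place (fun u hu => ?_) ?_
      · rcases hφ 0 (j + 1) (by omega) hj (by omega) u hu with ⟨a', h, -⟩ | ⟨b', h, rfl⟩
        · omega
        · exact Finset.mem_image_of_mem _ (Finset.mem_range.mpr (by omega))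
      · have := Finset.card_image_le (s := Finset.range (j + 1)) (f := φ 0)
        rw [Finset.card_range] at this
        omega
  -- The front of the sweep: the first `j` columns have already moved from row `a` to row `a + 1`.
  let St (a j : ℕ) : Finset V :=
    (Finset.range (c + 1)).image (fun b => φ (if b < j then a + 1 else a) b)
  have hSt : ∀ a j, (St a j).card ≤ c + 1 := fun a j => by
    have := Finset.card_image_le (s := Finset.range (c + 1))
      (f := fun b => φ (if b < j then a + 1 else a) b)
    rwa [Finset.card_range] at this
  have hsweep : ∀ a, a + 1 ≤ m → ∀ j ≤ c + 1, BlackReach G (c + 2) (St a 0) (St a j) := by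
    intro a ha j
    induction j with
    | zero => intro _; exact .refl
    | succ j ih =>
      intro hj
      have hmem : ∀ b, b ≤ c → φ (if b < j then a + 1 else a) b ∈ St a j := fun b hb =>
        Finset.mem_image_of_mem (fun b => φ (if b < j then a + 1 else a) b)
          (Finset.mem_range.mpr (by omega))
      refine (ih (by omega)).trans ((BlackReach.place (v := φ (a + 1) j) (fun u hu => ?_)
        (by have := hSt a j; omega)).trans (.drop ?_ ((hSt _ _).trans (by omega))))
      · rcases hφ (a + 1) j ha (by omega) (by omega) u hu with ⟨a', h, rfl⟩ | ⟨b', rfl, rfl⟩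
        · have := hmem j (by omega)
          rw [if_neg (lt_irrefl j)] at this
          rwa [show a' = a by omega]
        · have := hmem b' (by omega)
          rwa [if_pos (by omega)] at this
      · intro x hx
        obtain ⟨b, hb, rfl⟩ := Finset.mem_image.mp hx
        rw [Finset.mem_range] at hb
        rcases eq_or_ne b j with rfl | hne
        · rw [if_pos (by omega)]
          exact Finset.mem_insert_self _ _
        · refine Finset.mem_insert_of_mem ?_
          have := hmem b (by omega)
          by_cases h : b < j
          · rw [if_pos h] at this
            rwa [if_pos (by omega)]
          · rw [if_neg h] at this
            rwa [if_neg (by omega)]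
  have hrow : ∀ a ≤ m, BlackReach G (c + 2) {φ 0 0} ((Finset.range (c + 1)).image (φ a)) := by
    intro a
    induction a with
    | zero => intro _; exact hfirst c le_rfl
    | succ a ih =>
      intro ha
      have h := hsweep a ha (c + 1) le_rfl
      have e1 : St a 0 = (Finset.range (c + 1)).image (φ a) := by simp [St]
      have e2 : St a (c + 1) = (Finset.range (c + 1)).image (φ (a + 1)) :=
        Finset.image_congr fun b hb => by
          rw [Finset.mem_coe, Finset.mem_range] at hb
          simp only [if_pos hb]
      rw [e1, e2] at h
      exact (ih (by omega)).trans h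
  refine (hrow m le_rfl).trans (.drop ?_ (by simp))
  rw [Finset.singleton_subset_iff]
  exact Finset.mem_image_of_mem _ (by simp)

variable {q : V}

theorem BlackReach.attachDiamond {P P' : Finset V} {d : ℕ} (h : BlackReach G k P P') :
    BlackReach (attachDiamond G q d) k (P.image Sum.inl) (P'.image Sum.inl) := by
  refine Relation.ReflTransGen.lift
    (fun P => P.image (Sum.inl : V → V ⊕ DiamondInner d)) ?_ _ _ h
  rintro P P' ⟨⟨v, rfl, hv⟩ | hs, hc⟩
  · refine ⟨.inl ⟨.inl v, Finset.image_insert _ _ _, ?_⟩, Finset.card_image_le.trans hc⟩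
    rintro (u | u) hu
    · exact Finset.mem_image_of_mem _ (hv u hu)
    · exact hu.elim
  · exact ⟨.inr (Finset.image_subset_image hs), Finset.card_image_le.trans hc⟩

/-- A strategy for the graph below the diamond gives one for the graph with the diamond in the
spooky pebble game. -/
theorem spookyPebblable_attachDiamond [Finite V] (hk : 2 ≤ k)
    (hG : ∀ v, Relation.ReflTransGen G.Adj v q) (f : V ⊕ DiamondInner k → ℕ)
    (hf : ∀ u v, (attachDiamond G q k).Adj u v → f u < f v) (h : BlackReach G k ∅ {q}) :
    SpookyPebblable (attachDiamond G q k) (k + 1) := by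
  have hq : BlackReach (attachDiamond G q k) k ∅ {diamondVertex q k 0 0} := by
    rw [diamondVertex_zero]
    simpa using h.attachDiamond (q := q) (d := k)
  have hD : ∀ a b, a < k → b < k →
      BlackReach (attachDiamond G q k) (b + 2) {diamondVertex q k 0 0} {diamondVertex q k a b} :=
    fun a b ha hb => reach_rectangle (φ := diamondVertex q k) fun a' b' ha' hb' h0 u hu =>
      (attachDiamond_adj_iff (by omega) (by omega) h0).mp hu
  have hD' : ∀ a b, a < k → b < k →
      BlackReach (attachDiamond G q k) (a + 2) {diamondVertex q k 0 0} {diamondVertex q k a b} :=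
    fun a b ha hb => reach_rectangle (φ := fun x y => diamondVertex q k y x)
      fun a' b' ha' hb' h0 u hu =>
        ((attachDiamond_adj_iff (by omega) (by omega) (by omega)).mp hu).symm
  refine spookyPebblable_of_canPlace (attachDiamond_isRoot_iff hk hG) f hf ?_ ?_
  · rintro (v | v) hv
    · refine (hq.canPlace (Finset.mem_singleton_self _)).of_reaches ?_
      rw [diamondVertex_zero]
      exact Relation.ReflTransGen.lift Sum.inl (fun _ _ h => h) _ _ (hG v)
    · obtain ⟨a, b, ha, hb, -, e⟩ := exists_eq_diamondVertex (q := q) v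
      rw [e] at hv ⊢
      -- Any vertex but the output has a coordinate of at most `k - 2`; sweeping with lines of that
      -- length takes at most `k` pebbles.
      rcases Nat.lt_or_ge b (k - 1) with h | h
      · exact (hq.trans ((hD a b ha hb).mono (by omega))).canPlace (Finset.mem_singleton_self _)
      · rcases Nat.lt_or_ge a (k - 1) with h' | h'
        · exact (hq.trans ((hD' a b ha hb).mono (by omega))).canPlace (Finset.mem_singleton_self _)
        · exact absurd (by rw [show a = k - 1 by omega, show b = k - 1 by omega]) hv
  · exact ((hq.mono (by omega)).trans ((hD (k - 1) (k - 1) (by omega) (by omega)).mono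
      (by omega))).canPlace (Finset.mem_singleton_self _)

end Spooky

/-! ### From the spooky to the black pebble game -/

section Unspooky

variable {V : Type*} [DecidableEq V] {G : Digraph V} {k : ℕ}

/-- A vertex that is no output can be cleared of its pebble and its ghost only while its
predecessors are pebbled. -/
theorem IsSpookyStrategy.exists_unpebble {T : ℕ} {P S : ℕ → Finset V}
    (h : IsSpookyStrategy G T P S) {v : V} (hv : ¬ G.IsRoot v) {t : ℕ} (ht : t ≤ T)
    (hm : v ∈ P t) : ∃ t', t ≤ t' ∧ t' ≤ T ∧ ∀ u, G.Adj u v → u ∈ P t' := by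
  -- Pebble and ghost are tracked together: ghosting and unghosting only exchange one for the other,
  -- so only unpebbling can remove the last mark.
  obtain ⟨τ, h1, h2, h3, h4⟩ := exists_last_time (p := fun t => v ∈ P t ∨ v ∈ S t) ht (.inl hm)
    (by rw [h.pebbles_end, h.ghosts_end]; simpa using hv)
  refine ⟨τ, h1, h2.le, ?_⟩
  have h5 := h4 (τ + 1) (by omega) (by omega)
  obtain ⟨w, ⟨e1, e2, -⟩ | ⟨e1, e2, hw⟩ | ⟨e1, e2⟩ | ⟨e1, e2, -⟩⟩ := h.move τ h2 <;>
    rw [e1, e2] at h5 <;>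
    simp only [Finset.mem_union, Finset.mem_sdiff, Finset.mem_singleton] at h5
  · tauto
  · have : v = w := by tauto
    exact this ▸ hw
  · tauto
  · tauto

/-- A chain of vertices must be cleared from the top to the bottom. -/
theorem IsSpookyStrategy.exists_mem_chain {T : ℕ} {P S : ℕ → Finset V}
    (h : IsSpookyStrategy G T P S) (ψ : ℕ → V) {j : ℕ}
    (hψ : ∀ i < j, G.Adj (ψ i) (ψ (i + 1)) ∧ ¬ G.IsRoot (ψ (i + 1))) {t : ℕ} (ht : t ≤ T)
    (hm : ψ j ∈ P t) : ∃ t', t ≤ t' ∧ t' ≤ T ∧ ψ 0 ∈ P t' := by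
  induction j generalizing t with
  | zero => exact ⟨t, le_rfl, ht, hm⟩
  | succ j ih =>
    obtain ⟨t', h1, h2, h3⟩ := h.exists_unpebble (hψ j (by omega)).2 ht hm
    obtain ⟨tx, h4, h5, h6⟩ := ih (fun i hi => hψ i (by omega)) h2 (h3 _ (hψ j (by omega)).1)
    exact ⟨tx, by omega, h5, h6⟩

variable {q : V}

/-- The upper half of the diamond, turned so that the output is the apex; its `k` sources form the
antidiagonal with coordinate sum `k - 1`. -/
theorem isGrid_diamondVertex {V : Type*} {G : Digraph V} {q : V} : IsGrid (attachDiamond G q k)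
    (fun a b => diamondVertex q k (k - 1 - a) (k - 1 - b)) k where
  inj a b a' b' h h' he := by
    have := diamondVertex_injective (by omega) (by omega) (by omega) (by omega) he
    omega
  adj_left a b h := (attachDiamond_adj_iff (by omega) (by omega) (by omega)).mpr
    (.inl ⟨k - 1 - (a + 1), by omega, rfl⟩)
  adj_right a b h := (attachDiamond_adj_iff (by omega) (by omega) (by omega)).mpr
    (.inr ⟨k - 1 - (b + 1), by omega, rfl⟩)

theorem BlackMove.toLeft {P P' : Finset (V ⊕ DiamondInner k)}
    (h : BlackMove (attachDiamond G q k) P P') : BlackMove G P.toLeft P'.toLeft := by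
  rcases h with ⟨v | v, rfl, hv⟩ | hs
  · refine .inl ⟨v, Finset.toLeft_insert_inl, fun u hu => ?_⟩
    exact Finset.mem_toLeft.mpr (hv (.inl u) hu)
  · exact .inr (by rw [Finset.toLeft_insert_inr])
  · exact .inr (Finset.toLeft_subset_toLeft hs)

/-- A strategy in the spooky pebble game for the graph with a diamond pebbles the graph below the
diamond, while at least one pebble is on the diamond. -/
theorem SpookyPebblable.exists_black (hk : 3 ≤ k) (hG : ∀ v, Relation.ReflTransGen G.Adj v q)
    (h : SpookyPebblable (attachDiamond G q k) (k + 1)) :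
    ∃ P : ℕ → Finset V, (∀ t, BlackMove G (P t) (P (t + 1))) ∧ (∀ t, (P t).card ≤ k) ∧ P 0 = ∅ ∧
      ∃ t, q ∈ P t := by
  obtain ⟨T, P, S, hst, hcard⟩ := h
  set D := diamondVertex q k with hD
  set φ : ℕ → ℕ → V ⊕ DiamondInner k := fun a b => D (k - 1 - a) (k - 1 - b) with hφ
  have hroot := attachDiamond_isRoot_iff (G := G) (q := q) (k := k) (by omega) hG
  have hgrid : IsGrid (attachDiamond G q k) φ k := isGrid_diamondVertex
  -- The strategy is frozen after time `T`, so that every step is a black move.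
  let R : ℕ → Finset (V ⊕ DiamondInner k) := fun t => P (min t T)
  have hR : ∀ t, BlackMove (attachDiamond G q k) (R t) (R (t + 1)) := by
    intro t
    rcases Nat.lt_or_ge t T with h | h
    · simp only [R, Nat.min_eq_left h.le, Nat.min_eq_left (Nat.succ_le_of_lt h)]
      exact (hst.move t h).blackMove
    · simp only [R, Nat.min_eq_right h, Nat.min_eq_right (Nat.le_succ_of_le h)]
      exact .inr subset_rfl
  have hRc : ∀ t, (R t).card ≤ k + 1 := fun t => hcard _ (Nat.min_le_right _ _)
  have hinr : ∀ a b, a < k → b < k → ¬ (a = 0 ∧ b = 0) → ∃ w, D a b = .inr w :=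
    fun a b ha hb h0 => ⟨_, diamondVertex_of_pos ha hb h0⟩
  have ho : φ 0 0 = D (k - 1) (k - 1) := rfl
  obtain ⟨τ, -, h2, -, h4, -, ⟨a, ha, hins, hpred⟩, h6⟩ :=
    hgrid.exists_last_fill (F := {φ 0 0}) (fun v hv => by
      rw [Set.mem_singleton_iff.mp hv]
      exact .inr ⟨hgrid.adj_right 0 0 (by omega), hgrid.adj_left 0 0 (by omega)⟩) (by omega) hR
      (show 0 ≤ T by omega)
      (.of_forall_notMem (by simp [R, hst.pebbles_zero]) (by simp [R, hst.pebbles_zero]))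
      (fun h => h.2 _ rfl (by simp only [R, min_self]; rw [hst.pebbles_end, hroot, ho]))
  -- the upper half of the diamond always carries a pebble from then on
  have hup : ∀ t, τ < t → t ≤ T → ∃ w, Sum.inr w ∈ R t := by
    intro t ht ht'
    obtain ⟨x, hx, hx' | hx'⟩ := exists_mem_of_not_gridOpen (h4 t ht ht')
    · obtain ⟨a, b, -, hab, rfl⟩ := mem_gridCells.mp hx'
      obtain ⟨w, hw⟩ := hinr (k - 1 - a) (k - 1 - b) (by omega) (by omega) (by omega)
      exact ⟨w, hw ▸ hx⟩
    · rw [Set.mem_singleton_iff] at hx'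
      obtain ⟨w, hw⟩ := hinr (k - 1) (k - 1) (by omega) (by omega) (by omega)
      exact ⟨w, by rw [← hw, ← ho, ← hx']; exact hx⟩
  have hsub : R τ ⊆ R (τ + 1) := by rw [hins]; exact Finset.subset_insert _ _
  -- the source placed last has predecessors below the upper half
  have hout : ∀ x y, x + y = k - 2 → D x y ∉ R (τ + 1) ∩ gridCells φ k := by
    intro x y hxy hm
    obtain ⟨a, b, -, hab, he⟩ := mem_gridCells.mp (Finset.mem_inter.mp hm).2
    have := diamondVertex_injective (by omega) (by omega) (by omega) (by omega) he
    omega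
  -- The grid has at least `k` of the at most `k + 1` pebbles; one more on the diamond just below it
  -- leaves none for `G`.
  have hempty : ∀ x y, x + y = k - 2 → D x y ∈ R (τ + 1) → (R (τ + 1)).toLeft = ∅ := by
    intro x y hxy hm
    have e : insert (D x y) (R (τ + 1) ∩ gridCells φ k) = R (τ + 1) := by
      refine Finset.eq_of_subset_of_card_le ?_ ?_
      · exact Finset.insert_subset hm Finset.inter_subset_left
      · rw [Finset.card_insert_of_notMem (hout x y hxy)]
        exact (hRc _).trans (by omega)
    rw [Finset.eq_empty_iff_forall_notMem]
    intro v hv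
    rw [Finset.mem_toLeft, ← e] at hv
    rcases Finset.mem_insert.mp hv with hv | hv
    · obtain ⟨w, hw⟩ := hinr x y (by omega) (by omega) (by omega)
      rw [hw] at hv
      exact absurd hv (by simp)
    · obtain ⟨a, b, -, hab, he⟩ := mem_gridCells.mp (Finset.mem_inter.mp hv).2
      obtain ⟨w, hw⟩ := hinr (k - 1 - a) (k - 1 - b) (by omega) (by omega) (by omega)
      rw [show φ a b = D (k - 1 - a) (k - 1 - b) from rfl, hw] at he
      exact absurd he (by simp)
  have hchain : (R (τ + 1)).toLeft = ∅ ∧ ∃ t, τ + 1 ≤ t ∧ t ≤ T ∧ .inl q ∈ P t := by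
    have hpreds : ∀ u, (∃ a', k - 1 - a = a' + 1 ∧ u = D a' (k - 1 - (k - 1 - a))) ∨
        (∃ b', k - 1 - (k - 1 - a) = b' + 1 ∧ u = D (k - 1 - a) b') → u ∈ R (τ + 1) := fun u hu =>
      hsub (hpred u ((attachDiamond_adj_iff (by omega) (by omega) (by omega)).mpr hu))
    have hRP : R (τ + 1) = P (τ + 1) := by simp only [R, Nat.min_eq_left (Nat.succ_le_of_lt h2)]
    have hnot : ∀ x y, x < k → y < k → x + y < 2 * (k - 1) →
        ¬ (attachDiamond G q k).IsRoot (D x y) := by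
      intro x y hx hy hxy hr
      rw [hroot] at hr
      have := diamondVertex_injective (by omega) (by omega) (by omega) (by omega) hr
      omega
    rcases Nat.eq_zero_or_pos a with rfl | hapos
    · -- the corner `(k - 1, 0)`
      have hm := hpreds (D (k - 2) 0) (.inl ⟨k - 2, by omega, by congr 1; omega⟩)
      refine ⟨hempty (k - 2) 0 (by omega) hm, ?_⟩
      obtain ⟨t, e1, e2, e3⟩ := hst.exists_mem_chain (fun j => D j 0) (j := k - 2)
        (fun i hi => ⟨(attachDiamond_adj_iff (by omega) (by omega) (by omega)).mpr
          (.inl ⟨i, rfl, rfl⟩), hnot _ _ (by omega) (by omega) (by omega)⟩)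
        (Nat.succ_le_of_lt h2) (hRP ▸ hm)
      exact ⟨t, e1, e2, by simpa only [hD, diamondVertex_zero] using e3⟩
    · rcases Nat.lt_or_ge a (k - 1) with hlt | hge
      -- A source off the corners has two predecessors below the grid, which would make `k + 2`
      -- pebbles.
      · exfalso
        have m1 := hpreds (D (k - 2 - a) a) (.inl ⟨k - 2 - a, by omega, by congr 1; omega⟩)
        have m2 := hpreds (D (k - 1 - a) (a - 1)) (.inr ⟨a - 1, by omega, rfl⟩)
        have n1 : D (k - 2 - a) a ∉ insert (D (k - 1 - a) (a - 1))
            (R (τ + 1) ∩ gridCells φ k) := by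
          intro hm
          rcases Finset.mem_insert.mp hm with he | hm
          · have := diamondVertex_injective (by omega) (by omega) (by omega) (by omega) he
            omega
          · exact hout _ _ (by omega) hm
        have c1 := Finset.card_insert_of_notMem n1
        rw [Finset.card_insert_of_notMem (hout _ _ (by omega))] at c1
        have c2 : insert (D (k - 2 - a) a) (insert (D (k - 1 - a) (a - 1))
            (R (τ + 1) ∩ gridCells φ k)) ⊆ R (τ + 1) :=
          Finset.insert_subset m1 (Finset.insert_subset m2 Finset.inter_subset_left)
        have c3 := Finset.card_le_card c2
        have c4 := hRc (τ + 1)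
        omega
      · -- the corner `(0, k - 1)`
        have hm := hpreds (D 0 (k - 2)) (.inr ⟨k - 2, by omega, by congr 1; omega⟩)
        refine ⟨hempty 0 (k - 2) (by omega) hm, ?_⟩
        obtain ⟨t, e1, e2, e3⟩ := hst.exists_mem_chain (fun j => D 0 j) (j := k - 2)
          (fun i hi => ⟨(attachDiamond_adj_iff (by omega) (by omega) (by omega)).mpr
            (.inr ⟨i, rfl, rfl⟩), hnot _ _ (by omega) (by omega) (by omega)⟩)
          (Nat.succ_le_of_lt h2) (hRP ▸ hm)
        exact ⟨t, e1, e2, by simpa only [hD, diamondVertex_zero] using e3⟩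
  obtain ⟨he, t, e1, e2, e3⟩ := hchain
  refine ⟨fun s => (R (τ + 1 + s)).toLeft, fun s => (hR _).toLeft, fun s => ?_, he,
    t - (τ + 1), ?_⟩
  · have hex : ∃ w, Sum.inr w ∈ R (τ + 1 + s) := by
      rcases le_total (τ + 1 + s) T with h | h
      · exact hup _ (by omega) h
      · have := hup T h2 le_rfl
        simpa only [R, Nat.min_eq_right h, min_self] using this
    obtain ⟨w, hw⟩ := hex
    have c1 := Finset.card_toLeft_add_card_toRight (u := R (τ + 1 + s))
    have c2 : 0 < (R (τ + 1 + s)).toRight.card := Finset.card_pos.mpr ⟨w, by simpa using hw⟩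
    have c3 := hRc (τ + 1 + s)
    simp only
    omega
  · simp only [R]
    rw [Finset.mem_toLeft, show τ + 1 + (t - (τ + 1)) = t by omega, Nat.min_eq_left e2]
    exact e3

end Unspooky

/-! ### The reduction -/

namespace QCNF

variable (Φ : QCNF)

theorem isTrue_iff_spookyPebblable :
    Φ.IsTrue ↔ SpookyPebblable Φ.spookyGraph (3 * Φ.numVars + 5) := by
  constructor
  · intro h
    exact spookyPebblable_attachDiamond (by omega) reaches_outFrom_zero spookyRank
      (fun _ _ => spookyRank_lt_of_adj) (reach_of_isTrue h)
  · intro h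
    obtain ⟨P, h1, h2, h3, t, ht⟩ :=
      SpookyPebblable.exists_black (by omega) reaches_outFrom_zero h
    exact isTrue_of_pebbled h1 h2 h3 ht

theorem existsUnique_isRoot : ∃! v, Φ.spookyGraph.IsRoot v :=
  ⟨_, (attachDiamond_isRoot_iff (by omega) reaches_outFrom_zero _).mpr rfl,
    fun _ h => (attachDiamond_isRoot_iff (by omega) reaches_outFrom_zero _).mp h⟩

theorem spookyGraph_properties :
    Finite Φ.SpookyVertex ∧ Φ.spookyGraph.IsAcyclic ∧ (∃! v, Φ.spookyGraph.IsRoot v) ∧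
      Nat.card Φ.SpookyVertex ≤ 100 * Φ.size ^ 3 ∧
      (Φ.IsTrue ↔ SpookyPebblable Φ.spookyGraph (3 * Φ.numVars + 5)) :=
  ⟨inferInstance, .of_rank spookyRank fun _ _ => spookyRank_lt_of_adj, Φ.existsUnique_isRoot,
    Φ.card_spookyVertex_le, Φ.isTrue_iff_spookyPebblable⟩

end QCNF

theorem mainTheorem3 :
    ∃ C : ℕ,
      (∀ Φ : QCNF,
        Finite Φ.SpookyVertex ∧
        Φ.spookyGraph.IsAcyclic ∧
        (∃! v, Φ.spookyGraph.IsRoot v) ∧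
        Nat.card Φ.SpookyVertex ≤ C * Φ.size ^ 3 ∧
        (Φ.IsTrue ↔ SpookyPebblable Φ.spookyGraph (3 * Φ.numVars + 5))) ∧
      (∀ F : QBF,
        Finite F.toQCNF.SpookyVertex ∧
        F.toQCNF.spookyGraph.IsAcyclic ∧
        (∃! v, F.toQCNF.spookyGraph.IsRoot v) ∧
        Nat.card F.toQCNF.SpookyVertex ≤ C * F.size ^ 3 ∧
        (F.IsTrue ↔ SpookyPebblable F.toQCNF.spookyGraph (3 * F.toQCNF.numVars + 5))) := by
  -- `21600 = 100 * 6 ^ 3`, where 6 is the blow-up of the clausal form.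
  refine ⟨21600, fun Φ => ?_, fun F => ?_⟩
  · obtain ⟨h1, h2, h3, h4, h5⟩ := Φ.spookyGraph_properties
    exact ⟨h1, h2, h3, h4.trans (Nat.mul_le_mul_right _ (by norm_num)), h5⟩
  · obtain ⟨h1, h2, h3, h4, h5⟩ := F.toQCNF.spookyGraph_properties
    refine ⟨h1, h2, h3, h4.trans ?_, F.toQCNF_isTrue.symm.trans h5⟩
    calc 100 * F.toQCNF.size ^ 3 ≤ 100 * (6 * F.size) ^ 3 := by
          gcongr
          exact F.toQCNF_size_le
      _ = 21600 * F.size ^ 3 := by ring
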